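/- Let $\mathcal S,\mathcal A$ be finite sets with $|\mathcal S|,|\mathcal A|>1$, let $P(\cdot\mid s,a)$ be a transition law, $\nu_0$ an initial distribution on $\mathcal S$, $\gamma\in(0,1)$ and $H_\gamma=1/(1-\gamma)$. Let $E,P:\mathbb R^{\mathcal S}\to\mathbb R^{\mathcal S\times\mathcal A}$ be given by $(Ev)(s,a)=v(s)$ and $(Pv)(s,a)=\sum_{s'}P(s'\mid s,a)v(s')$. Let $$\mathcal M=\{\mu\in\mathbb R^{\mathcal S\times\mathcal A}_{+}:(E-\gamma P)^\top\mu=(1-\gamma)\nu_0\}$$ be the set of occupancy measures and $\mathcal U=\operatorname{im}(E-\gamma P)$; equip $\mathbb R^{\mathcal S\times\mathcal A}/\mathcal U$ with the quotient norm of $\|\cdot\|_2$. Suppose that $\nu_{\min}>0$ and $\nu^\mu(s):=\sum_a\mu(s,a)\ge\nu_{\min}$ for all $s\in\mathcal S$, $\mu\in\mathcal M$. For a policy regularizer $h$ put $\pi^\mu_s(a)=\mu(s,a)/\nu^\mu(s)$, $\bar h(\mu)=\sum_{s,a}\mu(s,a)\,h(\pi^\mu_s)$, $J(r,\mu)=\langle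 r,\mu\rangle-\bar h(\mu)$, $f^*(r)=\max_{\mu\in\mathcal M}J(r,\mu)$, $\mathsf{RL}(r)=\arg\max_{\mu\in\mathcal M}J(r,\mu)$ and $\mathsf{SubOpt}(r,\mu)=f^*(r)-J(r,\mu)$. Let $\mathcal R\subset\mathbb R^{\mathcal S\times\mathcal A}$ be compact, $R=\max_{r\in\mathcal R}\|r\|_\infty$, $D=\max_{r,r'\in\mathcal R}\|r-r'\|_2$, and $0<\tau<D$. Let $h$ be either the Shannon regularizer $h(p)=\tau\sum_a p(a)\log p(a)$ or the Tsallis-$1/2$ regularizer $h(p)=-2\tau\big(\sum_a\sqrt{p(a)}-1\big)$, and set, respectively, $$\eta=\frac{\tau\nu_{\min}}{H_\gamma^2},\qquad \sigma_{\mathcal R}=\frac{e^{-2RH_\gamma/\tau}\,\nu_{\min}}{2D|\mathcal S||\mathcal A|^{2+H_\gamma}}\qquad\text{(Shannon)},$$ $$\eta=\frac{\tau\nu_{\min}}{2H_\gamma^2|\mathcal A|},\qquad \sigma_{\mathcal R}=\frac{\nu_{\min}}{2\sqrt2\,D|\mathcal S||\mathcal A|\big((2R/\tau+3\sqrt{|\mathcal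 A|})H_\gamma\big)^3}\qquad\text{(Tsallis)}.$$ Then, in both cases: (a) $\bar h$ is $\eta$-strongly convex on $\mathcal M$ with respect to $\|\cdot\|_2$, i.e. $\bar h(\alpha\mu+(1-\alpha)\mu')\le\alpha\bar h(\mu)+(1-\alpha)\bar h(\mu')-\frac{\eta}{2}\alpha(1-\alpha)\|\mu-\mu'\|_2^2$ for all $\mu,\mu'\in\mathcal M$, $\alpha\in[0,1]$; moreover $\bar h$ is differentiable at every $\mu\in\operatorname{relint}\mathcal M$, and $\bar h(\mu')\ge\bar h(\mu)+\langle\nabla\bar h(\mu),\mu'-\mu\rangle+\frac{\eta}{2}\|\mu'-\mu\|_2^2$ for all $\mu\in\operatorname{relint}\mathcal M$, $\mu'\in\mathcal M$. (b) For every closed convex $\mathcal K\subset\operatorname{relint}\mathcal M$ there is $L_{\mathcal K}>0$ with $\|\nabla\bar h(\mu)-\nabla\bar h(\mu')\|_2\le L_{\mathcal K}\|\mu-\mu'\|_2$ for all $\mu,\mu'\in\mathcal K$. (c) For all $r,r'\in\mathcal R$: $f^*$ is differentiable at $r$, $\mathsf{RL}(r)$ is a single point, and $$f^*(r')\ge f^*(r)+\langle\nabla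 f^*(r),r'-r\rangle+\frac{\sigma_{\mathcal R}}{2}\big\|[r']_{\mathcal U}-[r]_{\mathcal U}\big\|_2^2,\qquad \frac{\sigma_{\mathcal R}}{2}\big\|[r]_{\mathcal U}-[r']_{\mathcal U}\big\|_2^2\le\mathsf{SubOpt}(r',\mathsf{RL}(r)).$$ -/

import Mathlib

noncomputable section

/-- The data of a finite discounted Markov decision process apart from reward and regularizer:
the transition law `P s a s' = P(s' | s, a)`, the initial distribution `ν₀`, and the discount
factor `γ ∈ (0, 1)`. -/
structure MDPModel (S A : Type*) [Fintype S] [Fintype A] where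
  P : S → A → S → ℝ
  P_mem : ∀ s a, P s a ∈ stdSimplex ℝ S
  ν₀ : S → ℝ
  ν₀_mem : ν₀ ∈ stdSimplex ℝ S
  γ : ℝ
  γ_pos : 0 < γ
  γ_lt_one : γ < 1

/-- The Shannon entropy of `p`, with `0 log 0 = 0`. -/
def shannonEntropy {A : Type*} [Fintype A] (p : A → ℝ) : ℝ :=
  -∑ a, p a * Real.log (p a)

/-- The Tsallis entropy of `p` with parameter `α`. -/
def tsallisEntropy {A : Type*} [Fintype A] (α : ℝ) (p : A → ℝ) : ℝ :=
  1 / (α - 1) * (1 - ∑ a, p a ^ α)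

/-- The policy regularizer `h = -τ ℋ`. -/
def shannonRegularizer {A : Type*} [Fintype A] (τ : ℝ) (p : A → ℝ) : ℝ :=
  -τ * shannonEntropy p

/-- The policy regularizer `h = -τ ℋ_{1/2}`. -/
def tsallisRegularizer {A : Type*} [Fintype A] (τ : ℝ) (p : A → ℝ) : ℝ :=
  -τ * tsallisEntropy (1 / 2) p

/-- The state marginal `ν(s) = ∑ₐ μ(s, a)`. -/
def stateMarginal {S A : Type*} [Fintype S] [Fintype A]
    (μ : EuclideanSpace ℝ (S × A)) (s : S) : ℝ :=
  ∑ a, μ (s, a)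

/-- The policy `π^μ(a | s) = μ(s, a) / ν(s)` (uniform where `ν(s)` is not positive). -/
def policyOf {S A : Type*} [Fintype S] [Fintype A]
    (μ : EuclideanSpace ℝ (S × A)) (s : S) (a : A) : ℝ :=
  if 0 < stateMarginal μ s then μ (s, a) / stateMarginal μ s else 1 / (Fintype.card A : ℝ)

/-- The occupancy regularizer `h̄(μ) = 𝔼_{(s,a) ∼ μ} [h(π^μ(· | s))]`. -/
def occReg {S A : Type*} [Fintype S] [Fintype A] (h : (A → ℝ) → ℝ)
    (μ : EuclideanSpace ℝ (S × A)) : ℝ :=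
  ∑ s, ∑ a, μ (s, a) * h (policyOf μ s)

/-- The regularized objective `J(r, μ) = ⟨r, μ⟩ - h̄(μ)`. -/
def regObjective {S A : Type*} [Fintype S] [Fintype A] (h : (A → ℝ) → ℝ)
    (r μ : EuclideanSpace ℝ (S × A)) : ℝ :=
  inner ℝ r μ - occReg h μ

/-- `R = max_{r ∈ 𝓡} ‖r‖_∞`; the norm of the underlying function is the maximum norm. -/
def rewardBound {S A : Type*} [Fintype S] [Fintype A]
    (rewards : Set (EuclideanSpace ℝ (S × A))) : ℝ :=
  sSup ((fun r : EuclideanSpace ℝ (S × A) => ‖(WithLp.ofLp r : S × A → ℝ)‖) '' rewards)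

namespace MDPModel

variable {S A : Type*} [Fintype S] [Fintype A]

/-- The operator `(E v)(s, a) = v(s)`. -/
def opE (S A : Type*) [Fintype S] [Fintype A] :
    EuclideanSpace ℝ S →ₗ[ℝ] EuclideanSpace ℝ (S × A) where
  toFun v := WithLp.toLp 2 fun x => v x.1
  map_add' v w := by ext x; simp
  map_smul' c v := by ext x; simp

/-- The operator `(P v)(s, a) = ∑_{s'} P(s' | s, a) v(s')`. -/
def opP (m : MDPModel S A) : EuclideanSpace ℝ S →ₗ[ℝ] EuclideanSpace ℝ (S × A) where
  toFun v := WithLp.toLp 2 fun x => ∑ s', m.P x.1 x.2 s' * v s'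
  map_add' v w := by ext x; simp [mul_add, Finset.sum_add_distrib]
  map_smul' c v := by ext x; simp [Finset.mul_sum, mul_left_comm]

/-- The set `𝓜` of occupancy measures: nonnegative solutions of the Bellman flow constraints
`(E - γ P)ᵀ μ = (1 - γ) ν₀`. -/
def occ (m : MDPModel S A) : Set (EuclideanSpace ℝ (S × A)) :=
  {μ | (∀ x, 0 ≤ μ x) ∧
    LinearMap.adjoint (opE S A - m.γ • m.opP) μ = (1 - m.γ) • WithLp.toLp 2 m.ν₀}

/-- The potential shaping subspace `𝓤 = im (E - γ P)`. -/
def shaping (m : MDPModel S A) : Submodule ℝ (EuclideanSpace ℝ (S × A)) :=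
  LinearMap.range (opE S A - m.γ • m.opP)

/-- `‖[r]_𝓤 - [r']_𝓤‖₂`, in the quotient norm induced by the Euclidean norm. -/
def quotDist (m : MDPModel S A) (r r' : EuclideanSpace ℝ (S × A)) : ℝ :=
  ‖(m.shaping.mkQ r - m.shaping.mkQ r' : EuclideanSpace ℝ (S × A) ⧸ m.shaping)‖

/-- The effective horizon `H_γ = 1 / (1 - γ)`. -/
def horizon (m : MDPModel S A) : ℝ := 1 / (1 - m.γ)

/-- The set `RL(r) = argmax_{μ ∈ 𝓜} J(r, μ)` of optimal occupancy measures. -/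
def optOcc (m : MDPModel S A) (h : (A → ℝ) → ℝ) (r : EuclideanSpace ℝ (S × A)) :
    Set (EuclideanSpace ℝ (S × A)) :=
  {μ | μ ∈ m.occ ∧ ∀ μ' ∈ m.occ, regObjective h r μ' ≤ regObjective h r μ}

/-- The convex conjugate `f*(r) = sup_μ (⟨r, μ⟩ - f(μ))` of `f = h̄ + δ_𝓜`. As `f = +∞`
outside `𝓜`, the supremum runs over `𝓜`; its value is `max_{μ ∈ 𝓜} J(r, μ)`. -/
def conj (m : MDPModel S A) (h : (A → ℝ) → ℝ) (r : EuclideanSpace ℝ (S × A)) : ℝ :=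
  sSup (regObjective h r '' m.occ)

/-- `SubOpt(r, μ) = max_{μ' ∈ 𝓜} J(r, μ') - J(r, μ)`. -/
def subOpt (m : MDPModel S A) (h : (A → ℝ) → ℝ) (r μ : EuclideanSpace ℝ (S × A)) : ℝ :=
  sSup (regObjective h r '' m.occ) - regObjective h r μ

/-- The regularity assumption with strong convexity constant `η`.

`strongConvex` is `η`-strong convexity of `h̄` on all of `𝓜` (in the Euclidean norm), in the form
that needs no gradient, because `h̄` need not be differentiable at the relative boundary of `𝓜`;
`firstOrder` is the gradient inequality at every base point in the relative interior. -/
structure IsRegular (m : MDPModel S A) (h : (A → ℝ) → ℝ) (η : ℝ) : Prop where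
  strongConvex : StrongConvexOn m.occ η (occReg h)
  differentiable : ∀ μ ∈ intrinsicInterior ℝ m.occ, DifferentiableAt ℝ (occReg h) μ
  firstOrder : ∀ μ ∈ intrinsicInterior ℝ m.occ, ∀ μ' ∈ m.occ,
    occReg h μ + inner ℝ (gradient (occReg h) μ) (μ' - μ) + η / 2 * ‖μ' - μ‖ ^ 2 ≤ occReg h μ'
  locallyLipschitz : ∀ K : Set (EuclideanSpace ℝ (S × A)), IsClosed K → Convex ℝ K →
    K ⊆ intrinsicInterior ℝ m.occ → ∃ L : ℝ, 0 < L ∧ ∀ μ ∈ K, ∀ μ' ∈ K,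
      ‖gradient (occReg h) μ - gradient (occReg h) μ'‖ ≤ L * ‖μ - μ'‖

/-- `σ` is a dual strong convexity constant on the reward class: for rewards `r, r'` in the class,
`f*(r') ≥ f*(r) + ⟨∇f*(r), r' - r⟩ + σ/2 ‖[r'] - [r]‖²`, and the unique optimal occupancy measure
`RL(r)` satisfies `σ/2 ‖[r] - [r']‖² ≤ SubOpt(r', RL(r))`. -/
structure IsDualConstant (m : MDPModel S A) (h : (A → ℝ) → ℝ)
    (rewards : Set (EuclideanSpace ℝ (S × A))) (σ : ℝ) : Prop where
  differentiable : ∀ r ∈ rewards, DifferentiableAt ℝ (m.conj h) r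
  dualStrongConvex : ∀ r ∈ rewards, ∀ r' ∈ rewards,
    m.conj h r + inner ℝ (gradient (m.conj h) r) (r' - r) + σ / 2 * m.quotDist r' r ^ 2
      ≤ m.conj h r'
  subOpt_lower : ∀ r ∈ rewards, ∃ μ, m.optOcc h r = {μ} ∧ ∀ r' ∈ rewards,
    σ / 2 * m.quotDist r r' ^ 2 ≤ m.subOpt h r' μ

end MDPModel

end

section

open Finset Topology

/-! ### The polytope of occupancy measures. -/

namespace MDPModel

variable {S A : Type*} [Fintype S] [Fintype A]

/-! Both regularizers are separable on the simplex, `h p = ∑ φ (p a)`, with `φ x = τ x log x` or `φ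
x = 2τ (x - √x)`. The argument is run once for a kernel `φ` (`IsSeparableKernel`,
`SimplexStrongConvex`) and then specialised.

Primal side. `h̄` is a sum over states of perspectives of `h`, so a mixture of occupancy measures
induces, in each state, a mixture of their policies with marginal-weighted coefficients. Strong
convexity of `h` in `ℓ¹` therefore gives a gap in terms of policy distances (`occReg_combo_le`), and
`sum_abs_sub_le` turns policy distances into distances of occupancy measures at the cost of the
horizon. Relative interior points have positive coordinates, so `h̄` is `C²` there, which gives the
gradient statements.

Dual side. Strong convexity makes `f*` differentiable with gradient the unique maximizer `μ` at `r`.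
Since `f*(r) + ⟨μ, r' - r⟩ = J(r', μ)`, both inequalities in (c) say that `μ` is suboptimal for `r'`
by a multiple of the squared quotient distance. A better competitor is `μ + ε d`, with `d` the
projection of `r' - r` onto `𝓤ᗮ`. The infinite slope of `φ` at `0` makes `μ` positive
(`pos_of_mem_optOcc`), so `r` minus the gradient at `μ` lies in `𝓤` (`sub_occGrad_mem_shaping`) and
the first-order gain is `ε ‖d‖²`. The second-order loss is controlled by `occReg_bregman_le`, given
a lower bound on the policy, which comes from the Bellman equation (`occGrad_ge`). -/

theorem adjoint_bellman_apply (m : MDPModel S A) (μ : EuclideanSpace ℝ (S × A)) (s : S) :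
    LinearMap.adjoint (opE S A - m.γ • m.opP) μ s
      = stateMarginal μ s - m.γ * ∑ x : S × A, m.P x.1 x.2 s * μ x := by
  classical
  have h := LinearMap.adjoint_inner_right (opE S A - m.γ • m.opP)
    (EuclideanSpace.single s (1 : ℝ)) μ
  rw [EuclideanSpace.inner_single_left] at h
  simp only [map_one, one_mul] at h
  rw [h, PiLp.inner_apply]
  simp only [opE, opP, stateMarginal, LinearMap.sub_apply, LinearMap.smul_apply,
    LinearMap.coe_mk, AddHom.coe_mk, PiLp.sub_apply, PiLp.smul_apply, smul_eq_mul,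
    RCLike.inner_apply, conj_trivial]
  simp only [PiLp.single_apply, mul_ite, mul_one, mul_zero, sum_ite_eq', mem_univ,
    if_true, mul_sub, sum_sub_distrib, mul_sum]
  congr 1
  · rw [Fintype.sum_prod_type, sum_eq_single s] <;> simp +contextual
  · exact sum_congr rfl fun x _ => by ring

theorem mem_occ_iff (m : MDPModel S A) (μ : EuclideanSpace ℝ (S × A)) :
    μ ∈ m.occ ↔ (∀ x, 0 ≤ μ x) ∧ ∀ s, stateMarginal μ s
      = (1 - m.γ) * m.ν₀ s + m.γ * ∑ x : S × A, m.P x.1 x.2 s * μ x := by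
  simp only [occ, Set.mem_ofPred_eq]
  refine and_congr_right fun _ => ⟨fun h s => ?_, fun h => ?_⟩
  · have := congrArg (fun v : EuclideanSpace ℝ S => v s) h
    simp only [adjoint_bellman_apply, PiLp.smul_apply, smul_eq_mul] at this
    linarith
  · ext s
    simp only [adjoint_bellman_apply, PiLp.smul_apply, smul_eq_mul]
    linarith [h s]

theorem sum_stateMarginal (μ : EuclideanSpace ℝ (S × A)) :
    ∑ s, stateMarginal μ s = ∑ x, μ x := by
  rw [Fintype.sum_prod_type]; rfl

theorem sum_transition (m : MDPModel S A) (f : S × A → ℝ) :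
    ∑ s, ∑ x : S × A, m.P x.1 x.2 s * f x = ∑ x, f x := by
  rw [sum_comm]
  refine sum_congr rfl fun x _ => ?_
  rw [← sum_mul, (m.P_mem x.1 x.2).2, one_mul]

theorem sum_eq_one_of_mem_occ {m : MDPModel S A} {μ : EuclideanSpace ℝ (S × A)}
    (hμ : μ ∈ m.occ) : ∑ x, μ x = 1 := by
  have h := sum_stateMarginal μ
  simp only [((m.mem_occ_iff μ).1 hμ).2, sum_add_distrib, ← mul_sum, m.sum_transition,
    m.ν₀_mem.2] at h
  have := m.γ_lt_one
  have h2 : (1 - m.γ) * (∑ x, μ x - 1) = 0 := by linarith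
  rcases mul_eq_zero.1 h2 with h3 | h3 <;> linarith

theorem apply_le_one_of_mem_occ {m : MDPModel S A} {μ : EuclideanSpace ℝ (S × A)}
    (hμ : μ ∈ m.occ) (x : S × A) : μ x ≤ 1 := by
  rw [← sum_eq_one_of_mem_occ hμ]
  exact single_le_sum (f := fun x => μ x) (fun i _ => hμ.1 i) (mem_univ x)

theorem sum_stateMarginal_eq_one {m : MDPModel S A} {μ : EuclideanSpace ℝ (S × A)}
    (hμ : μ ∈ m.occ) : ∑ s, stateMarginal μ s = 1 := by
  rw [sum_stateMarginal, sum_eq_one_of_mem_occ hμ]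

theorem stateMarginal_nonneg {m : MDPModel S A} {μ : EuclideanSpace ℝ (S × A)}
    (hμ : μ ∈ m.occ) (s : S) : 0 ≤ stateMarginal μ s := sum_nonneg fun a _ => hμ.1 (s, a)

theorem stateMarginal_le_one {m : MDPModel S A} {μ : EuclideanSpace ℝ (S × A)}
    (hμ : μ ∈ m.occ) (s : S) : stateMarginal μ s ≤ 1 := by
  rw [← sum_stateMarginal_eq_one hμ]
  exact single_le_sum (fun i _ => stateMarginal_nonneg hμ i) (mem_univ s)

theorem convex_occ (m : MDPModel S A) : Convex ℝ m.occ := by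
  intro μ hμ μ' hμ' a b ha hb hab
  refine ⟨fun x => ?_, ?_⟩
  · simp only [PiLp.add_apply, PiLp.smul_apply, smul_eq_mul]
    exact add_nonneg (mul_nonneg ha (hμ.1 x)) (mul_nonneg hb (hμ'.1 x))
  · rw [map_add, map_smul, map_smul, hμ.2, hμ'.2, ← add_smul, hab, one_smul]

theorem isCompact_occ (m : MDPModel S A) : IsCompact m.occ := by
  refine Metric.isCompact_of_isClosed_isBounded ?_ ?_
  · have h1 : IsClosed {μ : EuclideanSpace ℝ (S × A) | ∀ x, 0 ≤ μ x} := by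
      simp only [Set.ofPred_forall]
      exact isClosed_iInter fun x => isClosed_le continuous_const (by fun_prop)
    refine h1.inter (isClosed_eq ?_ continuous_const)
    exact LinearMap.continuous_of_finiteDimensional _
  · refine (Metric.isBounded_closedBall (x := (0 : EuclideanSpace ℝ (S × A))) (r := 1)).subset ?_
    intro μ hμ
    rw [mem_closedBall_zero_iff, EuclideanSpace.norm_eq, ← Real.sqrt_one]
    refine Real.sqrt_le_sqrt ?_
    rw [← sum_eq_one_of_mem_occ hμ]
    refine sum_le_sum fun x _ => ?_
    rw [Real.norm_eq_abs, sq_abs]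
    nlinarith [hμ.1 x, apply_le_one_of_mem_occ hμ x]

/-- The witness is the occupancy measure of the uniform policy. Its state marginal solves `v = (1 -
γ) ν₀ + γ U v` with `U` nonexpansive in `ℓ¹`, so `1 - γ U` is injective, hence invertible. -/
theorem exists_pos_mem_occ [Nonempty A] (m : MDPModel S A)
    (hpos : ∀ μ ∈ m.occ, ∀ s, 0 < stateMarginal μ s) :
    ∃ μ ∈ m.occ, ∀ x, 0 < μ x := by
  set c : ℝ := (Fintype.card A : ℝ) with hc
  have hc0 : 0 < c := by rw [hc]; exact_mod_cast Fintype.card_pos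
  have hγ0 := m.γ_pos
  have hγ1 := m.γ_lt_one
  let U : (S → ℝ) → S → ℝ := fun v s => ∑ x : S × A, m.P x.1 x.2 s * (v x.1 / c)
  have hU1 : ∀ v, ∑ s, U v s = ∑ s, v s := by
    intro v
    rw [m.sum_transition (fun x => v x.1 / c), Fintype.sum_prod_type]
    refine sum_congr rfl fun s _ => ?_
    simp only [sum_const, card_univ, nsmul_eq_mul, ← hc]
    field_simp
  have hU1' : ∀ v : S → ℝ, ∑ s, U |v| s = ∑ s, |v s| := fun v => hU1 |v|
  have habs : ∀ v s, |U v s| ≤ U |v| s := by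
    intro v s
    refine (abs_sum_le_sum_abs _ _).trans (sum_le_sum fun x _ => ?_)
    rw [abs_mul, abs_div, abs_of_nonneg ((m.P_mem x.1 x.2).1 s), abs_of_pos hc0]
    rfl
  let T : (S → ℝ) →ₗ[ℝ] (S → ℝ) :=
    { toFun := fun v s => v s - m.γ * U v s
      map_add' := by
        intro v w; ext s
        simp only [U, Pi.add_apply, add_div, mul_add, sum_add_distrib]; ring
      map_smul' := by
        intro k v; ext s
        simp only [U, Pi.smul_apply, smul_eq_mul, RingHom.id_apply, mul_sub, mul_sum]
        congr 1
        exact sum_congr rfl fun x _ => by ring }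
  have hinj : Function.Injective T := by
    rw [← LinearMap.ker_eq_bot, LinearMap.ker_eq_bot']
    intro v hv
    have h1 : ∀ s, v s = m.γ * U v s := fun s => by
      have := congrFun hv s
      simp only [T, LinearMap.coe_mk, AddHom.coe_mk, Pi.zero_apply] at this
      linarith
    have h2 : ∑ s, |v s| ≤ m.γ * ∑ s, |v s| := by
      conv_rhs => rw [← hU1' v, mul_sum]
      refine sum_le_sum fun s _ => ?_
      have h2 := mul_le_mul_of_nonneg_left (habs v s) hγ0.le
      have h3 := congrArg abs (h1 s)
      rw [abs_mul, abs_of_pos hγ0] at h3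
      exact h3.trans_le h2
    have h3 : 0 ≤ ∑ s, |v s| := sum_nonneg fun s _ => abs_nonneg _
    have h4 : ∑ s, |v s| = 0 := by nlinarith
    ext s
    exact abs_eq_zero.1 ((sum_eq_zero_iff_of_nonneg fun s _ => abs_nonneg _).1 h4 s (mem_univ s))
  obtain ⟨v, hv⟩ := LinearMap.injective_iff_surjective.1 hinj (fun s => (1 - m.γ) * m.ν₀ s)
  have h1 : ∀ s, v s = (1 - m.γ) * m.ν₀ s + m.γ * U v s := fun s => by
    have := congrFun hv s
    simp only [T, LinearMap.coe_mk, AddHom.coe_mk] at this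
    linarith
  have hs : ∑ s, v s = 1 := by
    have h2 : ∑ s, v s = (1 - m.γ) + m.γ * ∑ s, v s := by
      conv_lhs => simp only [h1]
      rw [sum_add_distrib, ← mul_sum, ← mul_sum, hU1, m.ν₀_mem.2, mul_one]
    nlinarith
  have habs1 : ∑ s, |v s| ≤ 1 := by
    have h2 : ∑ s, |v s| ≤ (1 - m.γ) + m.γ * ∑ s, |v s| := by
      calc ∑ s, |v s| ≤ ∑ s, ((1 - m.γ) * m.ν₀ s + m.γ * U |v| s) := by
            refine sum_le_sum fun s _ => ?_
            conv_lhs => rw [h1 s]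
            refine (abs_add_le _ _).trans (add_le_add ?_ ?_)
            · rw [abs_of_nonneg (mul_nonneg (by linarith) (m.ν₀_mem.1 s))]
            · rw [abs_mul, abs_of_pos hγ0]
              exact mul_le_mul_of_nonneg_left (habs v s) hγ0.le
        _ = _ := by rw [sum_add_distrib, ← mul_sum, ← mul_sum, hU1', m.ν₀_mem.2, mul_one]
    nlinarith
  -- Total mass `1` together with `ℓ¹` norm at most `1` leaves no room for negative entries.
  have hnn : ∀ s, 0 ≤ v s := by
    have h2 : ∑ s, (|v s| - v s) = 0 :=
      le_antisymm (by rw [sum_sub_distrib]; linarith)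
        (sum_nonneg fun s _ => sub_nonneg.2 (le_abs_self _))
    intro s
    have := (sum_eq_zero_iff_of_nonneg fun s _ => sub_nonneg.2 (le_abs_self _)).1 h2 s (mem_univ s)
    linarith [abs_nonneg (v s)]
  let μ : EuclideanSpace ℝ (S × A) := WithLp.toLp 2 fun x => v x.1 / c
  have hm : ∀ s, stateMarginal μ s = v s := fun s => by
    simp only [stateMarginal, μ, sum_const, card_univ, nsmul_eq_mul, ← hc]
    field_simp
  have hμ : μ ∈ m.occ := by
    rw [mem_occ_iff]
    exact ⟨fun x => div_nonneg (hnn _) hc0.le, fun s => by rw [hm, h1 s]⟩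
  exact ⟨μ, hμ, fun x => div_pos (by rw [← hm]; exact hpos μ hμ x.1) hc0⟩

/-- Every point of the relative interior of a convex set can be written as a proper convex
combination of any given point of the set and another point of the set. -/
theorem _root_.exists_combo_of_mem_intrinsicInterior {E : Type*} [NormedAddCommGroup E]
    [NormedSpace ℝ E] {s : Set E} {x y : E} (hx : x ∈ intrinsicInterior ℝ s) (hy : y ∈ s) :
    ∃ t : ℝ, 0 < t ∧ x + t • (x - y) ∈ s := by
  obtain ⟨⟨x', hx'⟩, hint, rfl⟩ := hx
  simp only at hx' ⊢
  have hy' : y ∈ affineSpan ℝ s := subset_affineSpan ℝ s hy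
  let f : ℝ → affineSpan ℝ s := fun t => ⟨AffineMap.lineMap x' y (-t),
    AffineMap.lineMap_mem _ hx' hy'⟩
  have hf : Continuous f := by
    refine Continuous.subtype_mk ?_ _
    simp only [AffineMap.lineMap_apply_module']
    fun_prop
  have h0 : f 0 = ⟨x', hx'⟩ := by simp [f]
  have hn : f ⁻¹' interior (((↑) : affineSpan ℝ s → E) ⁻¹' s) ∈ nhds (0 : ℝ) := by
    refine (isOpen_interior.preimage hf).mem_nhds ?_
    rw [Set.mem_preimage, h0]; exact hint
  obtain ⟨ε, hε, hball⟩ := Metric.mem_nhds_iff.1 hn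
  refine ⟨ε / 2, by positivity, ?_⟩
  have h1 : ε / 2 ∈ Metric.ball (0 : ℝ) ε := by
    rw [Metric.mem_ball, dist_zero_right, Real.norm_eq_abs, abs_of_pos (by positivity)]
    linarith
  have h2 : (f (ε / 2) : E) ∈ s := by
    have := interior_subset (hball h1)
    exact this
  simp only [f, AffineMap.lineMap_apply_module'] at h2
  convert h2 using 1
  module

/-- The segment from a strictly positive point can be prolonged slightly beyond `μ` inside the set;
a zero coordinate of `μ` would become negative there. -/
theorem pos_of_mem_intrinsicInterior [Nonempty A] {m : MDPModel S A}
    (hpos : ∀ μ ∈ m.occ, ∀ s, 0 < stateMarginal μ s) {μ : EuclideanSpace ℝ (S × A)}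
    (hμ : μ ∈ intrinsicInterior ℝ m.occ) (x : S × A) : 0 < μ x := by
  obtain ⟨μ₀, h₀, hp⟩ := m.exists_pos_mem_occ hpos
  obtain ⟨t, ht, h⟩ := exists_combo_of_mem_intrinsicInterior hμ h₀
  have h1 := h.1 x
  simp only [PiLp.add_apply, PiLp.smul_apply, PiLp.sub_apply, smul_eq_mul] at h1
  nlinarith [mul_pos ht (hp x), (intrinsicInterior_subset hμ).1 x]

theorem horizon_pos (m : MDPModel S A) : 0 < m.horizon :=
  one_div_pos.2 (by linarith [m.γ_lt_one])

/-- The `ℓ¹` distance of occupancy measures is bounded by the average `ℓ¹` distance of the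
policies. -/
theorem sum_abs_sub_le (m : MDPModel S A) {μ μ' : EuclideanSpace ℝ (S × A)} (hμ : μ ∈ m.occ)
    (hμ' : μ' ∈ m.occ) (π π' : S → A → ℝ) (hπ : ∀ s, π s ∈ stdSimplex ℝ A)
    (h : ∀ s a, μ (s, a) = stateMarginal μ s * π s a)
    (h' : ∀ s a, μ' (s, a) = stateMarginal μ' s * π' s a) :
    ∑ x, |μ x - μ' x| ≤
      m.horizon * ∑ s, stateMarginal μ' s * ∑ a, |π s a - π' s a| := by
  have hγ0 := m.γ_pos
  have hγ1 := m.γ_lt_one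
  -- The flow constraints drive both marginals through the same transition kernel, so the marginal
  -- error is at most `γ` times the total error, which can then be absorbed on the left.
  have h1 : ∑ s, |stateMarginal μ s - stateMarginal μ' s| ≤ m.γ * ∑ x, |μ x - μ' x| := by
    rw [← m.sum_transition (fun x => |μ x - μ' x|), mul_sum]
    refine sum_le_sum fun s _ => ?_
    rw [((m.mem_occ_iff μ).1 hμ).2, ((m.mem_occ_iff μ').1 hμ').2, add_sub_add_left_eq_sub,
      ← mul_sub, ← sum_sub_distrib, abs_mul, abs_of_pos hγ0]
    refine mul_le_mul_of_nonneg_left ((abs_sum_le_sum_abs _ _).trans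
      (sum_le_sum fun x _ => ?_)) hγ0.le
    rw [← mul_sub, abs_mul, abs_of_nonneg ((m.P_mem x.1 x.2).1 s)]
  have h2 : ∑ x, |μ x - μ' x| ≤ ∑ s, stateMarginal μ' s * ∑ a, |π s a - π' s a|
      + ∑ s, |stateMarginal μ s - stateMarginal μ' s| := by
    rw [Fintype.sum_prod_type, ← sum_add_distrib]
    refine sum_le_sum fun s _ => ?_
    have : |stateMarginal μ s - stateMarginal μ' s|
        = ∑ a, |stateMarginal μ s - stateMarginal μ' s| * π s a := by
      rw [← mul_sum, (hπ s).2, mul_one]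
    rw [this, mul_sum, ← sum_add_distrib]
    refine sum_le_sum fun a _ => ?_
    have e : μ (s, a) - μ' (s, a) = stateMarginal μ' s * (π s a - π' s a)
        + (stateMarginal μ s - stateMarginal μ' s) * π s a := by rw [h, h']; ring
    rw [e]
    refine (abs_add_le _ _).trans ?_
    rw [abs_mul, abs_mul, abs_of_nonneg ((hπ s).1 a), abs_of_nonneg (stateMarginal_nonneg hμ' s)]
  rw [horizon, div_mul_eq_mul_div, one_mul, le_div_iff₀ (by linarith)]
  linarith

theorem norm_le_sum_abs {ι : Type*} [Fintype ι] (v : EuclideanSpace ℝ ι) :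
    ‖v‖ ≤ ∑ i, |v i| := by
  rw [EuclideanSpace.norm_eq]
  refine Real.sqrt_le_iff.2 ⟨sum_nonneg fun _ _ => abs_nonneg _, ?_⟩
  simp only [Real.norm_eq_abs]
  exact sum_sq_le_sq_sum_of_nonneg fun _ _ => abs_nonneg _

end MDPModel

/-! ### Strong convexity and differentiability of the conjugate. -/

theorem add_le_of_forall_mul_le {u C : ℝ} (h : ∀ t : ℝ, 0 < t → t ≤ 1 → u + (1 - t) * C ≤ 0) :
    u + C ≤ 0 := by
  have hlim : Filter.Tendsto (fun t : ℝ => u + (1 - t) * C) (𝓝[>] 0) (𝓝 (u + (1 - 0) * C)) :=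
    (Continuous.tendsto (by fun_prop) 0).mono_left nhdsWithin_le_nhds
  have := le_of_tendsto hlim
    (Filter.eventually_of_mem (Ioc_mem_nhdsGT one_pos) fun t ht => h t ht.1 ht.2)
  linarith

section StrongConvex

variable {E : Type*} [NormedAddCommGroup E] [InnerProductSpace ℝ E] {s : Set E} {f : E → ℝ}
  {η : ℝ}

theorem StrongConvexOn.apply_add_smul_le (hf : StrongConvexOn s η f) {x y : E} (hx : x ∈ s)
    (hy : y ∈ s) {t : ℝ} (h0 : 0 ≤ t) (h1 : t ≤ 1) :
    f (x + t • (y - x)) ≤ f x + t * (f y - f x - (1 - t) * (η / 2 * ‖y - x‖ ^ 2)) := by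
  have := hf.2 hx hy (show 0 ≤ 1 - t by linarith) h0 (by ring)
  rw [show x + t • (y - x) = (1 - t) • x + t • y by module, norm_sub_rev y x]
  refine this.trans (le_of_eq ?_)
  simp only [smul_eq_mul]
  ring

theorem StrongConvexOn.add_inner_gradient_le [CompleteSpace E] (hf : StrongConvexOn s η f)
    {x y : E} (hx : x ∈ s) (hy : y ∈ s) (hd : DifferentiableAt ℝ f x) :
    f x + inner ℝ (gradient f x) (y - x) + η / 2 * ‖y - x‖ ^ 2 ≤ f y := by
  have hder : HasDerivAt (fun t : ℝ => f (x + t • (y - x))) (inner ℝ (gradient f x) (y - x)) 0 := by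
    have h1 : HasFDerivAt f (InnerProductSpace.toDual ℝ E (gradient f x))
        (x + (0 : ℝ) • (y - x)) := by
      simpa using hd.hasGradientAt.hasFDerivAt
    have h2 : HasDerivAt (fun t : ℝ => x + t • (y - x)) (y - x) 0 := by
      simpa using ((hasDerivAt_id (0 : ℝ)).smul_const (y - x)).const_add x
    exact h1.comp_hasDerivAt (0 : ℝ) h2
  have hlim := hder.tendsto_slope_zero_right
  have hrhs : Filter.Tendsto (fun t : ℝ => f y - f x - (1 - t) * (η / 2 * ‖y - x‖ ^ 2))
      (𝓝[>] 0) (𝓝 (f y - f x - (1 - 0) * (η / 2 * ‖y - x‖ ^ 2))) :=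
    (Continuous.tendsto (by fun_prop) 0).mono_left nhdsWithin_le_nhds
  have hle := le_of_tendsto_of_tendsto hlim hrhs
    (Filter.eventually_of_mem (Ioc_mem_nhdsGT one_pos) fun t ht => by
      have := hf.apply_add_smul_le hx hy ht.1.le ht.2
      simp only [zero_add, zero_smul, add_zero, smul_eq_mul]
      rw [inv_mul_le_iff₀ ht.1]
      linarith)
  linarith

/-- Quadratic growth at a maximizer: compare with points on the segment towards `y`, divide by `t`
and let `t → 0`, which recovers the full modulus. -/
theorem StrongConvexOn.inner_sub_add_le (hf : StrongConvexOn s η f) {r x y : E}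
    (hx : x ∈ s) (hmax : ∀ z ∈ s, inner ℝ r z - f z ≤ inner ℝ r x - f x) (hy : y ∈ s) :
    inner ℝ r y - f y + η / 2 * ‖y - x‖ ^ 2 ≤ inner ℝ r x - f x := by
  have key := add_le_of_forall_mul_le (u := inner ℝ r y - f y - (inner ℝ r x - f x))
    (C := η / 2 * ‖y - x‖ ^ 2) fun t h0 h1 => ?_
  · linarith
  have h2 := hf.apply_add_smul_le hx hy h0.le h1
  have hmem : x + t • (y - x) ∈ s := by
    rw [show x + t • (y - x) = (1 - t) • x + t • y by module]
    exact hf.1 hx hy (by linarith) h0.le (by ring)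
  have h3 := hmax _ hmem
  rw [inner_add_right, inner_smul_right, inner_sub_right] at h3
  have h4 : t * (inner ℝ r y - f y - (inner ℝ r x - f x) + (1 - t) * (η / 2 * ‖y - x‖ ^ 2)) ≤ 0 := by
    linarith
  exact nonpos_of_mul_nonpos_right h4 h0

theorem StrongConvexOn.eq_of_isMax (hf : StrongConvexOn s η f) (hη : 0 < η) {r x y : E}
    (hx : x ∈ s) (hxmax : ∀ z ∈ s, inner ℝ r z - f z ≤ inner ℝ r x - f x)
    (hy : y ∈ s) (hymax : ∀ z ∈ s, inner ℝ r z - f z ≤ inner ℝ r y - f y) : y = x := by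
  have h1 := hf.inner_sub_add_le hx hxmax hy
  have h2 := hymax x hx
  have h3 : η / 2 * ‖y - x‖ ^ 2 ≤ 0 := by linarith
  have h4 : ‖y - x‖ ^ 2 ≤ 0 := nonpos_of_mul_nonpos_right h3 (by positivity)
  exact sub_eq_zero.1 (norm_eq_zero.1 (pow_eq_zero_iff (two_ne_zero) |>.1
    (le_antisymm h4 (sq_nonneg _))))

theorem sSup_image_eq_of_isMax {r x : E} (hx : x ∈ s)
    (hmax : ∀ z ∈ s, inner ℝ r z - f z ≤ inner ℝ r x - f x) :
    sSup ((fun z => inner ℝ r z - f z) '' s) = inner ℝ r x - f x :=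
  IsGreatest.csSup_eq ⟨⟨x, hx, rfl⟩, by rintro _ ⟨z, hz, rfl⟩; exact hmax z hz⟩

/-- The convex conjugate of a strongly convex function on a compact set is differentiable, and its
gradient is the maximizer. -/
theorem StrongConvexOn.hasGradientAt_conjugate [CompleteSpace E] (hf : StrongConvexOn s η f)
    (hη : 0 < η) (hs : IsCompact s) (hc : ContinuousOn f s) {r x : E} (hx : x ∈ s)
    (hmax : ∀ z ∈ s, inner ℝ r z - f z ≤ inner ℝ r x - f x) :
    HasGradientAt (fun r => sSup ((fun z => inner ℝ r z - f z) '' s)) x r := by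
  rw [hasGradientAt_iff_isLittleO]
  have hO : (fun r' => sSup ((fun z => inner ℝ r' z - f z) '' s)
      - sSup ((fun z => inner ℝ r z - f z) '' s) - inner ℝ x (r' - r))
      =O[𝓝 r] fun r' => ‖r' - r‖ ^ 2 := by
    refine Asymptotics.IsBigO.of_bound η⁻¹ (Filter.Eventually.of_forall fun r' => ?_)
    obtain ⟨y, hy, hymax⟩ := hs.exists_isMaxOn ⟨x, hx⟩
      ((continuous_const.inner continuous_id).continuousOn.sub hc :
        ContinuousOn (fun z => inner ℝ r' z - f z) s)
    have hymax' : ∀ z ∈ s, inner ℝ r' z - f z ≤ inner ℝ r' y - f y := fun z hz => hymax hz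
    rw [sSup_image_eq_of_isMax hx hmax, sSup_image_eq_of_isMax hy hymax']
    -- Adding quadratic growth at both maximizers gives `η ‖y - x‖² ≤ ⟨r' - r, y - x⟩`, so the
    -- maximizer is `η⁻¹`-Lipschitz in the reward. The remainder lies between `0` and `⟨r' - r, y -
    -- x⟩`, hence is quadratic.
    have h1 := hf.inner_sub_add_le hx hmax hy
    have h2 := hf.inner_sub_add_le hy hymax' hx
    have hcs : inner ℝ (r' - r) (y - x) ≤ ‖r' - r‖ * ‖y - x‖ := real_inner_le_norm _ _
    rw [norm_sub_rev x y] at h2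
    rw [inner_sub_left, inner_sub_right, inner_sub_right] at hcs
    have h3 : η * ‖y - x‖ ≤ ‖r' - r‖ := by
      rcases (norm_nonneg (y - x)).eq_or_lt with h0 | h0
      · rw [← h0, mul_zero]; exact norm_nonneg _
      · refine le_of_mul_le_mul_right ?_ h0
        nlinarith
    have h4 : ‖y - x‖ ≤ η⁻¹ * ‖r' - r‖ := by
      rw [le_inv_mul_iff₀ hη]; exact h3
    have h5 : η / 2 * ‖y - x‖ ^ 2 ≥ 0 := by positivity
    have e1 : inner ℝ x (r' - r) = inner ℝ r' x - inner ℝ r x := by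
      rw [real_inner_comm, inner_sub_left]
    rw [Real.norm_eq_abs, abs_of_nonneg (by rw [e1]; linarith), e1,
      Real.norm_of_nonneg (sq_nonneg _)]
    have h6 : ‖r' - r‖ * ‖y - x‖ ≤ ‖r' - r‖ * (η⁻¹ * ‖r' - r‖) :=
      mul_le_mul_of_nonneg_left h4 (norm_nonneg _)
    nlinarith
  exact hO.trans_isLittleO (Asymptotics.isLittleO_pow_sub_sub r one_lt_two)

end StrongConvex

/-- A scalar function `φ`, with derivative `φ'` on `(0, ∞)`, whose sum over the coordinates is a
regularizer on the simplex with infinite slope at the boundary; `K δ` bounds its Bregman divergence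
from base points above `δ`. -/
structure IsSeparableKernel (φ φ' K : ℝ → ℝ) : Prop where
  continuous : Continuous φ
  contDiffAt : ∀ x, 0 < x → ContDiffAt ℝ 2 φ x
  convexOn : ConvexOn ℝ (Set.Ici 0) φ
  zero : φ 0 = 0
  tendsto_div : Filter.Tendsto (fun x => φ x / x) (𝓝[>] 0) Filter.atBot
  K_pos : ∀ δ, 0 < δ → 0 < K δ
  bregman_le : ∀ δ, 0 < δ → ∀ x, δ ≤ x → ∀ y, 0 ≤ y →
    φ y - φ x - φ' x * (y - x) ≤ K δ * (y - x) ^ 2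

/-- `φ` generates the regularizer `h` on the affine span of the simplex. -/
def Generates {A : Type*} [Fintype A] (φ : ℝ → ℝ) (h : (A → ℝ) → ℝ) : Prop :=
  ∀ p : A → ℝ, ∑ a, p a = 1 → h p = ∑ a, φ (p a)

/-- Strong convexity with constant `c` of `∑ₐ φ(p a)` on the simplex, in the `ℓ¹` norm. -/
def SimplexStrongConvex (A : Type*) [Fintype A] (φ : ℝ → ℝ) (c : ℝ) : Prop :=
  ∀ p ∈ stdSimplex ℝ A, ∀ q ∈ stdSimplex ℝ A, ∀ a b : ℝ, 0 ≤ a → 0 ≤ b → a + b = 1 →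
    ∑ i, φ (a * p i + b * q i) + c / 2 * (a * b) * (∑ i, |p i - q i|) ^ 2
      ≤ a * ∑ i, φ (p i) + b * ∑ i, φ (q i)

/-! ### Regularity of the occupancy regularizer. -/

namespace MDPModel

variable {S A : Type*} [Fintype S] [Fintype A] {m : MDPModel S A}
  {μ μ' : EuclideanSpace ℝ (S × A)} {φ φ' K : ℝ → ℝ} {h : (A → ℝ) → ℝ} {νmin : ℝ}

theorem policyOf_eq {s : S} (hs : 0 < stateMarginal μ s) (a : A) :
    policyOf μ s a = μ (s, a) / stateMarginal μ s := if_pos hs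

theorem apply_eq_mul_policyOf {s : S} (hs : 0 < stateMarginal μ s) (a : A) :
    μ (s, a) = stateMarginal μ s * policyOf μ s a := by
  rw [policyOf_eq hs, mul_div_cancel₀ _ hs.ne']

theorem sum_policyOf [Nonempty A] (μ : EuclideanSpace ℝ (S × A)) (s : S) :
    ∑ a, policyOf μ s a = 1 := by
  unfold policyOf
  split_ifs with hs
  · rw [← sum_div]; exact div_self hs.ne'
  · rw [sum_const, card_univ, nsmul_eq_mul, mul_one_div_cancel]
    exact_mod_cast Fintype.card_ne_zero

theorem policyOf_mem_stdSimplex [Nonempty A] (hμ : ∀ x, 0 ≤ μ x) (s : S) :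
    policyOf μ s ∈ stdSimplex ℝ A := by
  refine ⟨fun a => ?_, sum_policyOf μ s⟩
  unfold policyOf
  split_ifs with hs
  · exact div_nonneg (hμ _) hs.le
  · positivity

theorem occReg_eq [Nonempty A] (hφ : Generates φ h) (μ : EuclideanSpace ℝ (S × A)) :
    occReg h μ = ∑ s, stateMarginal μ s * ∑ a, φ (policyOf μ s a) := by
  refine sum_congr rfl fun s _ => ?_
  rw [← sum_mul, hφ _ (sum_policyOf μ s)]
  rfl

theorem stateMarginal_combo (μ μ' : EuclideanSpace ℝ (S × A)) (a b : ℝ) (s : S) :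
    stateMarginal (a • μ + b • μ') s = a * stateMarginal μ s + b * stateMarginal μ' s := by
  simp [stateMarginal, sum_add_distrib, mul_sum]

theorem sq_sum_mul_le {ι : Type*} [Fintype ι] {w : ι → ℝ} (hw : ∀ i, 0 ≤ w i) (h1 : ∑ i, w i = 1)
    (x : ι → ℝ) : (∑ i, w i * x i) ^ 2 ≤ ∑ i, w i * x i ^ 2 := by
  have h0 : 0 ≤ ∑ i, w i * (x i - ∑ j, w j * x j) ^ 2 :=
    sum_nonneg fun i _ => mul_nonneg (hw i) (sq_nonneg _)
  have h2 : ∀ t : ℝ, ∑ i, w i * (x i - t) ^ 2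
      = ∑ i, w i * x i ^ 2 - 2 * t * ∑ i, w i * x i + t ^ 2 * ∑ i, w i := fun t => by
    rw [mul_sum, mul_sum, ← sum_sub_distrib, ← sum_add_distrib]
    exact sum_congr rfl fun i _ => by ring
  rw [h2, h1] at h0
  nlinarith

/-- In each state the mixture's policy has weights `a ν / N` and `b ν' / N`, where `N` is the mixed
marginal. Multiplying the simplex inequality by `N` linearises the values and leaves the gap factor
`a b ν ν' / N`. -/
theorem occReg_combo_le [Nonempty A] (hφ : Generates φ h) {c : ℝ} (hc : 0 ≤ c)
    (hsc : SimplexStrongConvex A φ c) (hνmin : 0 < νmin)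
    (hν : ∀ μ ∈ m.occ, ∀ s, νmin ≤ stateMarginal μ s)
    (hμ : μ ∈ m.occ) (hμ' : μ' ∈ m.occ) {a b : ℝ} (ha : 0 ≤ a) (hb : 0 ≤ b) (hab : a + b = 1) :
    occReg h (a • μ + b • μ')
        + c / 2 * (a * b) * νmin * ∑ s, stateMarginal μ' s *
          (∑ i, |policyOf μ s i - policyOf μ' s i|) ^ 2
      ≤ a * occReg h μ + b * occReg h μ' := by
  rw [occReg_eq hφ, occReg_eq hφ, occReg_eq hφ, mul_sum, mul_sum, mul_sum, ← sum_add_distrib,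
    ← sum_add_distrib]
  refine sum_le_sum fun s _ => ?_
  have hmem := m.convex_occ hμ hμ' ha hb hab
  set ν := stateMarginal μ s with hνdef
  set ν' := stateMarginal μ' s with hν'def
  have hpos : 0 < ν := hνmin.trans_le (hν μ hμ s)
  have hpos' : 0 < ν' := hνmin.trans_le (hν μ' hμ' s)
  set N := stateMarginal (a • μ + b • μ') s with hNdef
  have hN : N = a * ν + b * ν' := stateMarginal_combo μ μ' a b s
  have hN0 : 0 < N := hνmin.trans_le (hν _ hmem s)
  have hN1 : N ≤ 1 := stateMarginal_le_one hmem s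
  have hpol : ∀ i, policyOf (a • μ + b • μ') s i
      = (a * ν / N) * policyOf μ s i + (b * ν' / N) * policyOf μ' s i := fun i => by
    rw [policyOf_eq hN0, PiLp.add_apply, PiLp.smul_apply, PiLp.smul_apply,
      apply_eq_mul_policyOf hpos, apply_eq_mul_policyOf hpos']
    simp only [smul_eq_mul]
    ring
  have key := hsc _ (policyOf_mem_stdSimplex hμ.1 s) _ (policyOf_mem_stdSimplex hμ'.1 s)
    (a * ν / N) (b * ν' / N) (by positivity) (by positivity)
    (by rw [← add_div, ← hN, div_self hN0.ne'])
  simp only [hpol]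
  set X := ∑ i, |policyOf μ s i - policyOf μ' s i| with hX
  have h1 := mul_le_mul_of_nonneg_left key hN0.le
  have e1 : N * (a * ν / N * ∑ i, φ (policyOf μ s i) + b * ν' / N * ∑ i, φ (policyOf μ' s i))
      = a * (ν * ∑ i, φ (policyOf μ s i)) + b * (ν' * ∑ i, φ (policyOf μ' s i)) := by
    field_simp
  have e2 : N * (c / 2 * (a * ν / N * (b * ν' / N)) * X ^ 2)
      = c / 2 * (a * b) * (ν / N) * (ν' * X ^ 2) := by
    field_simp
  rw [e1, mul_add, e2] at h1
  -- This uses `N ≤ 1`; the other marginal `ν'` is kept as the weight for averaging over states.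
  have h2 : νmin ≤ ν / N := by
    rw [le_div_iff₀ hN0]
    nlinarith [hν μ hμ s]
  have h3 : c / 2 * (a * b) * νmin * (ν' * X ^ 2) ≤ c / 2 * (a * b) * (ν / N) * (ν' * X ^ 2) := by
    gcongr
  linarith

theorem strongConvexOn_occReg [Nonempty A] (hφ : Generates φ h) {c : ℝ} (hc : 0 ≤ c)
    (hsc : SimplexStrongConvex A φ c) (hνmin : 0 < νmin)
    (hν : ∀ μ ∈ m.occ, ∀ s, νmin ≤ stateMarginal μ s) :
    StrongConvexOn m.occ (c * νmin / m.horizon ^ 2) (occReg h) := by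
  refine ⟨m.convex_occ, fun μ hμ μ' hμ' a b ha hb hab => ?_⟩
  have h1 := occReg_combo_le hφ hc hsc hνmin hν hμ hμ' ha hb hab
  have hH := m.horizon_pos
  have hp : ∀ μ ∈ m.occ, ∀ s, 0 < stateMarginal μ s := fun μ hμ s => hνmin.trans_le (hν μ hμ s)
  have h2 := (norm_le_sum_abs (μ - μ')).trans (m.sum_abs_sub_le hμ hμ' (policyOf μ) (policyOf μ')
    (policyOf_mem_stdSimplex hμ.1) (fun s a => apply_eq_mul_policyOf (hp μ hμ s) a)
    (fun s a => apply_eq_mul_policyOf (hp μ' hμ' s) a))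
  have h3 := sq_sum_mul_le (stateMarginal_nonneg hμ') (sum_stateMarginal_eq_one hμ')
    (fun s => ∑ i, |policyOf μ s i - policyOf μ' s i|)
  have h4 : ‖μ - μ'‖ ^ 2 / m.horizon ^ 2 ≤ ∑ s, stateMarginal μ' s *
      (∑ i, |policyOf μ s i - policyOf μ' s i|) ^ 2 := by
    refine le_trans ?_ h3
    rw [div_le_iff₀ (by positivity), ← mul_pow, mul_comm _ m.horizon]
    exact pow_le_pow_left₀ (norm_nonneg _) h2 2
  have h5 := mul_le_mul_of_nonneg_left h4 (show 0 ≤ c / 2 * (a * b) * νmin by positivity)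
  simp only [smul_eq_mul]
  have e : a * b * (c * νmin / m.horizon ^ 2 / 2 * ‖μ - μ'‖ ^ 2)
      = c / 2 * (a * b) * νmin * (‖μ - μ'‖ ^ 2 / m.horizon ^ 2) := by ring
  rw [e]
  linarith

theorem contDiff_stateMarginal {n : WithTop ℕ∞} (s : S) :
    ContDiff ℝ n fun μ : EuclideanSpace ℝ (S × A) => stateMarginal μ s := by
  unfold stateMarginal
  fun_prop

theorem occReg_eventuallyEq [Nonempty A] (hφ : Generates φ h)
    (hμ : ∀ s, 0 < stateMarginal μ s) :
    occReg h =ᶠ[𝓝 μ] fun μ => ∑ s, stateMarginal μ s * ∑ a, φ (μ (s, a) / stateMarginal μ s) := by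
  have : ∀ᶠ ρ in 𝓝 μ, ∀ s, 0 < stateMarginal ρ s := Filter.eventually_all.2 fun s =>
    ((contDiff_stateMarginal (n := 0) s).continuous.tendsto μ).eventually_const_lt (hμ s)
  filter_upwards [this] with ρ hρ
  rw [occReg_eq hφ]
  refine sum_congr rfl fun s _ => ?_
  congr 1
  exact sum_congr rfl fun a _ => by rw [policyOf_eq (hρ s)]

theorem contDiffAt_occReg [Nonempty A] (hφ : Generates φ h) (hk : IsSeparableKernel φ φ' K)
    (hμ : ∀ x, 0 < μ x) : ContDiffAt ℝ 2 (occReg h) μ := by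
  have hs : ∀ s, 0 < stateMarginal μ s := fun s => sum_pos (fun a _ => hμ (s, a)) univ_nonempty
  refine ContDiffAt.congr_of_eventuallyEq ?_ (occReg_eventuallyEq hφ hs)
  refine ContDiffAt.sum fun s _ => (contDiff_stateMarginal s).contDiffAt.mul
    (ContDiffAt.sum fun a _ => ?_)
  refine ContDiffAt.comp μ (hk.contDiffAt _ (div_pos (hμ _) (hs s))) ?_
  exact ContDiffAt.div (by fun_prop) (contDiff_stateMarginal s).contDiffAt (hs s).ne'

theorem continuousOn_occReg [Nonempty A] (hφ : Generates φ h) (hk : IsSeparableKernel φ φ' K)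
    (hpos : ∀ μ ∈ m.occ, ∀ s, 0 < stateMarginal μ s) : ContinuousOn (occReg h) m.occ := by
  intro μ hμ
  refine ContinuousAt.continuousWithinAt ?_
  refine ContinuousAt.congr ?_ (occReg_eventuallyEq hφ (hpos μ hμ)).symm
  have hc : ∀ s, Continuous fun μ : EuclideanSpace ℝ (S × A) => stateMarginal μ s :=
    fun s => (contDiff_stateMarginal (n := 0) s).continuous
  refine tendsto_finsetSum _ fun s _ => ((hc s).continuousAt.mul
    (tendsto_finsetSum _ fun a _ => ?_))
  refine ContinuousAt.comp (g := φ) hk.continuous.continuousAt ?_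
  exact ContinuousAt.div (by fun_prop) (hc s).continuousAt (hpos μ hμ s).ne'

theorem isRegular_of_kernel [Nonempty A] (hφ : Generates φ h) (hk : IsSeparableKernel φ φ' K)
    {c : ℝ} (hc : 0 ≤ c) (hsc : SimplexStrongConvex A φ c) (hνmin : 0 < νmin)
    (hν : ∀ μ ∈ m.occ, ∀ s, νmin ≤ stateMarginal μ s) :
    m.IsRegular h (c * νmin / m.horizon ^ 2) := by
  have hp : ∀ μ ∈ m.occ, ∀ s, 0 < stateMarginal μ s := fun μ hμ s => hνmin.trans_le (hν μ hμ s)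
  have hcd : ∀ μ ∈ intrinsicInterior ℝ m.occ, ContDiffAt ℝ 2 (occReg h) μ := fun μ hμ =>
    contDiffAt_occReg hφ hk (pos_of_mem_intrinsicInterior hp hμ)
  have hd : ∀ μ ∈ intrinsicInterior ℝ m.occ, DifferentiableAt ℝ (occReg h) μ := fun μ hμ =>
    (hcd μ hμ).differentiableAt two_ne_zero
  have hsc' := strongConvexOn_occReg hφ hc hsc hνmin hν
  refine ⟨hsc', hd, fun μ hμ μ' hμ' =>
    hsc'.add_inner_gradient_le (intrinsicInterior_subset hμ) hμ' (hd μ hμ), ?_⟩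
  intro C hC hconv hsub
  have hcomp : IsCompact C :=
    m.isCompact_occ.of_isClosed_subset hC (hsub.trans intrinsicInterior_subset)
  -- A `C¹` map on a compact convex set is Lipschitz; here the map is the gradient of a `C²`
  -- function.
  have hgrad : ContDiffOn ℝ 1 (gradient (occReg h)) C := fun μ hμ =>
    ((InnerProductSpace.toDual ℝ (EuclideanSpace ℝ (S × A))).symm.contDiff.contDiffAt.comp μ
      ((hcd μ (hsub hμ)).fderiv_right (m := 1) (by norm_num))).contDiffWithinAt
  obtain ⟨L, hL⟩ := (hgrad.locallyLipschitzOn hconv).exists_lipschitzOnWith_of_compact hcomp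
  refine ⟨L + 1, by positivity, fun μ hμ μ' hμ' => ?_⟩
  have h1 := hL.dist_le_mul μ hμ μ' hμ'
  rw [dist_eq_norm, dist_eq_norm] at h1
  nlinarith [norm_nonneg (μ - μ')]

end MDPModel

/-- The oblique projection `v ↦ v - (∑ v) p`, for `p` in the simplex, has squared Euclidean norm at
most the number of coordinates. -/
theorem sum_sq_sub_mul_sum_le {A : Type*} [Fintype A] {p : A → ℝ} (hp : p ∈ stdSimplex ℝ A)
    (v : A → ℝ) :
    ∑ a, (v a - p a * ∑ b, v b) ^ 2 ≤ (Fintype.card A : ℝ) * ∑ a, v a ^ 2 := by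
  classical
  set t := ∑ b, v b with ht
  have h1 : ∀ t : ℝ, ∑ a, (v a - p a * t) ^ 2
      = ∑ a, v a ^ 2 - 2 * t * ∑ a, p a * v a + t ^ 2 * ∑ a, p a ^ 2 := fun t => by
    rw [mul_sum, mul_sum, ← sum_sub_distrib, ← sum_add_distrib]
    exact sum_congr rfl fun i _ => by ring
  have h2 : ∑ a, p a ^ 2 ≤ 1 := by
    rw [← hp.2]
    refine sum_le_sum fun a _ => ?_
    have : p a ≤ 1 := by
      rw [← hp.2]; exact single_le_sum (fun i _ => hp.1 i) (mem_univ a)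
    nlinarith [hp.1 a]
  -- The vertex case: Cauchy–Schwarz over the remaining `|A| - 1` coordinates bounds `(t - v b)²`.
  -- Once `∑ p² ≤ 1` is used, the bound needed is affine in `p`, so averaging over vertices
  -- suffices.
  have h3 : ∀ b, t ^ 2 - 2 * t * v b ≤ ((Fintype.card A : ℝ) - 1) * ∑ a, v a ^ 2 := by
    intro b
    have e1 : ∑ a ∈ univ.erase b, v a = t - v b := by
      rw [ht, ← add_sum_erase _ _ (mem_univ b)]; ring
    have e2 : ∑ a ∈ univ.erase b, v a ^ 2 = ∑ a, v a ^ 2 - v b ^ 2 := by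
      rw [← add_sum_erase univ (fun a => v a ^ 2) (mem_univ b)]; ring
    have h4 := sq_sum_le_card_mul_sum_sq (s := univ.erase b) (f := v)
    have hcard : ((univ.erase b).card : ℝ) = (Fintype.card A : ℝ) - 1 := by
      rw [card_erase_of_mem (mem_univ b), card_univ, Nat.cast_pred (Fintype.card_pos_iff.2 ⟨b⟩)]
    rw [e1, e2, hcard] at h4
    have h5 : (1 : ℝ) ≤ Fintype.card A := by exact_mod_cast Fintype.card_pos_iff.2 ⟨b⟩
    nlinarith [mul_nonneg (sub_nonneg.2 h5) (sq_nonneg (v b)), sq_nonneg (v b)]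
  have h4 : t ^ 2 - 2 * t * ∑ a, p a * v a ≤ ((Fintype.card A : ℝ) - 1) * ∑ a, v a ^ 2 := by
    have : ∑ b, p b * (t ^ 2 - 2 * t * v b) ≤ ∑ b, p b * (((Fintype.card A : ℝ) - 1)
        * ∑ a, v a ^ 2) := sum_le_sum fun b _ => mul_le_mul_of_nonneg_left (h3 b) (hp.1 b)
    rw [← sum_mul, hp.2, one_mul] at this
    refine le_trans (le_of_eq ?_) this
    simp only [mul_sub, sum_sub_distrib, ← sum_mul, hp.2, one_mul]
    congr 1
    rw [mul_sum]
    exact sum_congr rfl fun a _ => by ring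
  rw [h1]
  nlinarith [sq_nonneg t]

/-! ### First-order analysis at optimal occupancy measures. -/

namespace MDPModel

variable {S A : Type*} [Fintype S] [Fintype A] {m : MDPModel S A}
  {μ μ' : EuclideanSpace ℝ (S × A)} {φ φ' K : ℝ → ℝ} {h : (A → ℝ) → ℝ} {νmin : ℝ}

/-- The gradient of the occupancy regularizer generated by `φ`. -/
noncomputable def occGrad (φ φ' : ℝ → ℝ) (μ : EuclideanSpace ℝ (S × A)) :
    EuclideanSpace ℝ (S × A) :=
  WithLp.toLp 2 fun x => φ' (policyOf μ x.1 x.2) + ∑ a, φ (policyOf μ x.1 a)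
    - ∑ a, φ' (policyOf μ x.1 a) * policyOf μ x.1 a

/-- By degree-one homogeneity `⟨occGrad φ φ' μ, μ⟩ = h̄(μ)`, so the marginal of `μ` drops out and
only policy divergences weighted by the marginal of `μ'` remain. -/
theorem occReg_bregman [Nonempty A] (hφ : Generates φ h) (φ' : ℝ → ℝ)
    (hμ : ∀ s, 0 < stateMarginal μ s) (hμ' : ∀ s, 0 < stateMarginal μ' s) :
    occReg h μ' - occReg h μ - inner ℝ (occGrad φ φ' μ) (μ' - μ)
      = ∑ s, stateMarginal μ' s * ∑ a, (φ (policyOf μ' s a) - φ (policyOf μ s a)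
          - φ' (policyOf μ s a) * (policyOf μ' s a - policyOf μ s a)) := by
  rw [occReg_eq hφ, occReg_eq hφ, PiLp.inner_apply, Fintype.sum_prod_type, ← sum_sub_distrib,
    ← sum_sub_distrib]
  refine sum_congr rfl fun s _ => ?_
  simp only [occGrad, PiLp.sub_apply, RCLike.inner_apply, conj_trivial,
    apply_eq_mul_policyOf (hμ s), apply_eq_mul_policyOf (hμ' s)]
  set F := ∑ a, φ (policyOf μ s a)
  set G := ∑ a, φ' (policyOf μ s a) * policyOf μ s a with hG
  have e : ∑ a, (stateMarginal μ' s * policyOf μ' s a - stateMarginal μ s * policyOf μ s a)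
      * (φ' (policyOf μ s a) + F - G)
      = stateMarginal μ' s * ∑ a, φ' (policyOf μ s a) * policyOf μ' s a
        - stateMarginal μ s * G + (stateMarginal μ' s * ∑ a, policyOf μ' s a
        - stateMarginal μ s * ∑ a, policyOf μ s a) * (F - G) := by
    rw [hG, mul_sum, mul_sum, mul_sum, mul_sum, ← sum_sub_distrib, ← sum_sub_distrib, sum_mul,
      ← sum_add_distrib]
    exact sum_congr rfl fun a _ => by ring
  rw [e, sum_policyOf, sum_policyOf]
  simp only [sum_sub_distrib, mul_sub]
  ring

/-- Policy differences are turned back into measure differences through `ν' (π' - π) = (μ' - μ) - π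
∑ (μ' - μ)`. This oblique projection costs `|A|`, and one division by `ν'` costs `1 / νmin`. -/
theorem occReg_bregman_le [Nonempty A] (hφ : Generates φ h) (hk : IsSeparableKernel φ φ' K)
    (hνmin : 0 < νmin) (hν : ∀ μ ∈ m.occ, ∀ s, νmin ≤ stateMarginal μ s) (hμ : μ ∈ m.occ)
    (hμ' : μ' ∈ m.occ) {δ : ℝ} (hδ : 0 < δ) (hπ : ∀ s a, δ ≤ policyOf μ s a) :
    occReg h μ' - occReg h μ - inner ℝ (occGrad φ φ' μ) (μ' - μ)
      ≤ K δ * (Fintype.card A) / νmin * ‖μ' - μ‖ ^ 2 := by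
  have hp : ∀ μ ∈ m.occ, ∀ s, 0 < stateMarginal μ s := fun μ hμ s => hνmin.trans_le (hν μ hμ s)
  have hK := hk.K_pos δ hδ
  rw [occReg_bregman hφ φ' (hp μ hμ) (hp μ' hμ'), EuclideanSpace.norm_sq_eq,
    Fintype.sum_prod_type, mul_sum]
  refine sum_le_sum fun s _ => ?_
  simp only [Real.norm_eq_abs, sq_abs, PiLp.sub_apply]
  have hs := hp μ' hμ' s
  set ν' := stateMarginal μ' s with hν'
  have h1 : ∑ a, (φ (policyOf μ' s a) - φ (policyOf μ s a)
      - φ' (policyOf μ s a) * (policyOf μ' s a - policyOf μ s a))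
      ≤ K δ * ∑ a, (policyOf μ' s a - policyOf μ s a) ^ 2 := by
    rw [mul_sum]
    exact sum_le_sum fun a _ => hk.bregman_le δ hδ _ (hπ s a) _
      ((policyOf_mem_stdSimplex hμ'.1 s).1 a)
  have h2 := sum_sq_sub_mul_sum_le (policyOf_mem_stdSimplex hμ.1 s)
    (fun a => μ' (s, a) - μ (s, a))
  have h3 : ∑ b, (μ' (s, b) - μ (s, b)) = ν' - stateMarginal μ s := by
    rw [sum_sub_distrib]; rfl
  have h4 : ∀ a, μ' (s, a) - μ (s, a) - policyOf μ s a * (ν' - stateMarginal μ s)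
      = ν' * (policyOf μ' s a - policyOf μ s a) := fun a => by
    rw [apply_eq_mul_policyOf (hp μ hμ s), apply_eq_mul_policyOf (hp μ' hμ' s)]; ring
  simp only [h3, h4, mul_pow] at h2
  rw [← mul_sum] at h2
  set X := ∑ a, (policyOf μ' s a - policyOf μ s a) ^ 2
  set Y := ∑ a, (μ' (s, a) - μ (s, a)) ^ 2
  have hX : 0 ≤ X := sum_nonneg fun _ _ => sq_nonneg _
  have h5 : ν' * X ≤ (Fintype.card A) / νmin * Y := by
    rw [div_mul_eq_mul_div, le_div_iff₀ hνmin]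
    have := mul_le_mul_of_nonneg_left (hν μ' hμ' s) (mul_nonneg hs.le hX)
    nlinarith
  have h6 := mul_le_mul_of_nonneg_left h1 hs.le
  have h7 := mul_le_mul_of_nonneg_left h5 hK.le
  calc _ ≤ _ := h6
    _ = K δ * (ν' * X) := by ring
    _ ≤ _ := h7
    _ = _ := by ring

/-- Directions in `𝓤ᗮ` are killed by the adjoint Bellman operator, so they preserve the flow
constraints; nonnegativity survives because every entry of `μ` is at least `νmin * δ`. -/
theorem add_smul_mem_occ (hν : ∀ μ ∈ m.occ, ∀ s, νmin ≤ stateMarginal μ s)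
    (hνmin : 0 < νmin) (hμ : μ ∈ m.occ) {δ : ℝ} (hδ : 0 < δ) (hπ : ∀ s a, δ ≤ policyOf μ s a)
    {d : EuclideanSpace ℝ (S × A)} (hd : d ∈ m.shapingᗮ) {ε : ℝ} (hε : 0 ≤ ε)
    (hεd : ε * ‖d‖ ≤ νmin * δ) : μ + ε • d ∈ m.occ := by
  refine ⟨fun x => ?_, ?_⟩
  · have h1 : νmin * δ ≤ μ x := by
      rw [← Prod.mk.eta (p := x), apply_eq_mul_policyOf (hνmin.trans_le (hν μ hμ x.1))]
      exact mul_le_mul (hν μ hμ _) (hπ _ _) hδ.le (stateMarginal_nonneg hμ _)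
    have h2 : |d x| ≤ ‖d‖ := PiLp.norm_apply_le d x
    simp only [PiLp.add_apply, PiLp.smul_apply, smul_eq_mul]
    nlinarith [neg_abs_le (d x), mul_le_mul_of_nonneg_left h2 hε]
  · have h0 : LinearMap.adjoint (opE S A - m.γ • m.opP) d = 0 := by
      refine ext_inner_left ℝ fun v => ?_
      rw [LinearMap.adjoint_inner_right, inner_zero_right]
      exact hd _ ⟨v, rfl⟩
    rw [map_add, map_smul, h0, smul_zero, add_zero, hμ.2]

theorem regObjective_add_smul_ge [Nonempty A] (hφ : Generates φ h)
    (hk : IsSeparableKernel φ φ' K) (hνmin : 0 < νmin)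
    (hν : ∀ μ ∈ m.occ, ∀ s, νmin ≤ stateMarginal μ s) (hμ : μ ∈ m.occ)
    {δ : ℝ} (hδ : 0 < δ) (hπ : ∀ s a, δ ≤ policyOf μ s a)
    (r : EuclideanSpace ℝ (S × A)) {d : EuclideanSpace ℝ (S × A)} {ε : ℝ}
    (hmem : μ + ε • d ∈ m.occ) :
    regObjective h r μ + ε * inner ℝ (r - occGrad φ φ' μ) d
      - K δ * (Fintype.card A) / νmin * (ε ^ 2 * ‖d‖ ^ 2) ≤ regObjective h r (μ + ε • d) := by
  have h1 := occReg_bregman_le hφ hk hνmin hν hμ hmem hδ hπ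
  rw [add_sub_cancel_left, norm_smul, mul_pow, Real.norm_eq_abs, sq_abs, inner_smul_right] at h1
  rw [regObjective, regObjective, inner_add_right, inner_smul_right, inner_sub_left]
  linarith

/-- Stationarity: were the component `d` of `w` in `𝓤ᗮ` nonzero, a short step along `d` would gain
`ε ‖d‖²` and lose only `O(ε² ‖d‖²)`. -/
theorem sub_occGrad_mem_shaping [Nonempty A] (hφ : Generates φ h)
    (hk : IsSeparableKernel φ φ' K) (hνmin : 0 < νmin)
    (hν : ∀ μ ∈ m.occ, ∀ s, νmin ≤ stateMarginal μ s)
    {δ : ℝ} (hδ : 0 < δ) (hπ : ∀ s a, δ ≤ policyOf μ s a)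
    {r : EuclideanSpace ℝ (S × A)} (hμ : μ ∈ m.optOcc h r) :
    r - occGrad φ φ' μ ∈ m.shaping := by
  set w := r - occGrad φ φ' μ with hw
  set d := m.shapingᗮ.starProjection w with hd
  have hdmem : d ∈ m.shapingᗮ := Submodule.starProjection_apply_mem _ _
  have hwd : w - d ∈ m.shaping := by
    have := Submodule.sub_starProjection_mem_orthogonal (K := m.shapingᗮ) w
    rwa [Submodule.orthogonal_orthogonal] at this
  have hin : inner ℝ w d = ‖d‖ ^ 2 := by
    have h1 : inner ℝ (w - d) d = 0 := Submodule.inner_right_of_mem_orthogonal hwd hdmem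
    rw [inner_sub_left, real_inner_self_eq_norm_sq] at h1
    linarith
  set C := K δ * (Fintype.card A) / νmin with hC
  have hC0 : 0 < C := by
    have := hk.K_pos δ hδ
    have hcard : (0 : ℝ) < Fintype.card A := by exact_mod_cast Fintype.card_pos
    positivity
  have hd0 : ‖d‖ = 0 := by
    by_contra hne
    have hdpos : 0 < ‖d‖ := (norm_nonneg d).lt_of_ne' hne
    -- The first bound keeps the step feasible, the second keeps the loss at most half the gain.
    set ε := min (νmin * δ / ‖d‖) (1 / (2 * C)) with hε
    have hε0 : 0 < ε := lt_min (by positivity) (by positivity)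
    have h1 : ε * ‖d‖ ≤ νmin * δ := by
      rw [← le_div_iff₀ hdpos]; exact min_le_left _ _
    have h2 : ε * C ≤ 1 / 2 := by
      have : ε ≤ 1 / (2 * C) := min_le_right _ _
      rw [le_div_iff₀ (by positivity)] at this
      linarith
    have hmem := add_smul_mem_occ hν hνmin hμ.1 hδ hπ hdmem hε0.le h1
    have h3 := regObjective_add_smul_ge hφ hk hνmin hν hμ.1 hδ hπ r hmem
    have h4 := hμ.2 _ hmem
    rw [← hw, hin, ← hC] at h3
    have h5 : ε * ‖d‖ ^ 2 * (1 - ε * C) ≤ 0 := by nlinarith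
    have h6 : 0 < ε * ‖d‖ ^ 2 * (1 - ε * C) := by
      have : 0 < 1 - ε * C := by linarith
      positivity
    linarith
  rw [norm_eq_zero] at hd0
  rwa [hd0, sub_zero] at hwd

/-- A lower bound for the gradient of the regularizer at an optimal occupancy measure, from the
Bellman equation for the regularized value function. -/
theorem occGrad_ge [Nonempty A] [Nonempty S] {R B : ℝ}
    (hh0 : ∀ p ∈ stdSimplex ℝ A, ∑ a, φ (p a) ≤ 0)
    (hhB : ∀ p ∈ stdSimplex ℝ A, -B ≤ ∑ a, φ (p a)) (hμ : ∀ x, 0 ≤ μ x)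
    {r : EuclideanSpace ℝ (S × A)} (hr : ∀ x, |r x| ≤ R)
    (hmem : r - occGrad φ φ' μ ∈ m.shaping) (x : S × A) :
    -((2 * R + B) * m.horizon) ≤ occGrad φ φ' μ x := by
  obtain ⟨V, hV⟩ := hmem
  have hγ0 := m.γ_pos
  have hγ1 := m.γ_lt_one
  -- The potential `V` plays the role of the regularized value function and `occGrad` that of the
  -- advantage. Its policy average is `h(π)`, which turns this identity into the Bellman equation
  -- `hVeq`; the bounds on `V` follow at a maximal and a minimal state.
  have hb : ∀ x : S × A, occGrad φ φ' μ x
      = r x + m.γ * ∑ s', m.P x.1 x.2 s' * V s' - V x.1 := fun x => by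
    have := congrArg (fun v : EuclideanSpace ℝ (S × A) => v x) hV
    simp only [opE, opP, LinearMap.sub_apply, LinearMap.smul_apply, LinearMap.coe_mk,
      AddHom.coe_mk, PiLp.sub_apply, PiLp.smul_apply, smul_eq_mul] at this
    linarith
  have hav : ∀ s, ∑ a, policyOf μ s a * occGrad φ φ' μ (s, a) = ∑ a, φ (policyOf μ s a) := by
    intro s
    simp only [occGrad]
    set F := ∑ a, φ (policyOf μ s a)
    set G := ∑ a, φ' (policyOf μ s a) * policyOf μ s a with hG
    have e : ∑ a, policyOf μ s a * (φ' (policyOf μ s a) + F - G)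
        = G + (∑ a, policyOf μ s a) * (F - G) := by
      rw [hG, sum_mul, ← sum_add_distrib]
      exact sum_congr rfl fun a _ => by ring
    rw [e, sum_policyOf]; ring
  have hVeq : ∀ s, V s = ∑ a, policyOf μ s a *
      (r (s, a) + m.γ * ∑ s', m.P s a s' * V s') - ∑ a, φ (policyOf μ s a) := fun s => by
    rw [← hav s, ← sum_sub_distrib]
    simp only [hb, ← mul_sub, sub_sub_cancel]
    rw [← sum_mul, sum_policyOf, one_mul]
  have hπ := policyOf_mem_stdSimplex (μ := μ) hμ
  have hHγ : m.horizon * (1 - m.γ) = 1 := div_mul_cancel₀ _ (by linarith)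
  have hPle : ∀ s a M, (∀ s', V s' ≤ M) → ∑ s', m.P s a s' * V s' ≤ M := fun s a M hM => by
    calc _ ≤ ∑ s', m.P s a s' * M := sum_le_sum fun s' _ =>
          mul_le_mul_of_nonneg_left (hM s') ((m.P_mem s a).1 s')
      _ = M := by rw [← sum_mul, (m.P_mem s a).2, one_mul]
  have hPge : ∀ s a M, (∀ s', M ≤ V s') → M ≤ ∑ s', m.P s a s' * V s' := fun s a M hM => by
    calc M = ∑ s', m.P s a s' * M := by rw [← sum_mul, (m.P_mem s a).2, one_mul]
      _ ≤ _ := sum_le_sum fun s' _ =>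
          mul_le_mul_of_nonneg_left (hM s') ((m.P_mem s a).1 s')
  have hup : ∀ s, V s ≤ (R + B) * m.horizon := by
    obtain ⟨s₀, hs₀⟩ := Finite.exists_max (fun s => V s)
    have h1 : V s₀ ≤ (R + m.γ * V s₀) + B := by
      conv_lhs => rw [hVeq s₀]
      have h2 : ∑ a, policyOf μ s₀ a * (r (s₀, a) + m.γ * ∑ s', m.P s₀ a s' * V s')
          ≤ ∑ a, policyOf μ s₀ a * (R + m.γ * V s₀) :=
        sum_le_sum fun a _ => mul_le_mul_of_nonneg_left
          (add_le_add ((le_abs_self _).trans (hr _))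
            (mul_le_mul_of_nonneg_left (hPle s₀ a _ hs₀) hγ0.le)) ((hπ s₀).1 a)
      rw [← sum_mul, sum_policyOf, one_mul] at h2
      linarith [hhB _ (hπ s₀)]
    intro s
    refine (hs₀ s).trans ?_
    rw [horizon, mul_one_div, le_div_iff₀ (by linarith)]
    linarith
  have hlo : ∀ s, -(R * m.horizon) ≤ V s := by
    obtain ⟨s₀, hs₀⟩ := Finite.exists_min (fun s => V s)
    have h1 : -R + m.γ * V s₀ ≤ V s₀ := by
      conv_rhs => rw [hVeq s₀]
      have h2 : ∑ a, policyOf μ s₀ a * (-R + m.γ * V s₀)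
          ≤ ∑ a, policyOf μ s₀ a * (r (s₀, a) + m.γ * ∑ s', m.P s₀ a s' * V s') :=
        sum_le_sum fun a _ => mul_le_mul_of_nonneg_left
          (add_le_add ((neg_le_neg (hr _)).trans (neg_abs_le _))
            (mul_le_mul_of_nonneg_left (hPge s₀ a _ hs₀) hγ0.le)) ((hπ s₀).1 a)
      rw [← sum_mul, sum_policyOf, one_mul] at h2
      linarith [hh0 _ (hπ s₀)]
    intro s
    refine le_trans ?_ (hs₀ s)
    rw [horizon, mul_one_div, neg_le, ← sub_nonneg, ← sub_nonneg]
    rw [sub_nonneg, le_sub_comm, sub_zero, le_div_iff₀ (by linarith)]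
    linarith
  rw [hb x]
  have h1 := hPge x.1 x.2 _ hlo
  have h2 := hup x.1
  have h3 := (neg_le_neg (hr x)).trans (neg_abs_le _)
  have h4 := mul_le_mul_of_nonneg_left h1 hγ0.le
  have h5 : m.γ * -(R * m.horizon) = R - R * m.horizon := by
    linear_combination R * hHγ
  linarith

/-- Optimal occupancy measures are positive, as the kernel has infinite slope at `0`. -/
theorem pos_of_mem_optOcc [Nonempty A] (hφ : Generates φ h) (hk : IsSeparableKernel φ φ' K)
    (hpos : ∀ μ ∈ m.occ, ∀ s, 0 < stateMarginal μ s) {r : EuclideanSpace ℝ (S × A)}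
    (hμ : μ ∈ m.optOcc h r) (x : S × A) : 0 < μ x := by
  classical
  obtain ⟨μ₀, h₀, hp₀⟩ := m.exists_pos_mem_occ hpos
  by_contra hx
  have hx0 : μ x = 0 := le_antisymm (not_lt.1 hx) (hμ.1.1 x)
  let ρ : ℝ → EuclideanSpace ℝ (S × A) := fun t => (1 - t) • μ + t • μ₀
  have hρ : ∀ t, 0 ≤ t → t ≤ 1 → ρ t ∈ m.occ := fun t h0 h1 =>
    m.convex_occ hμ.1 h₀ (by linarith) h0 (by ring)
  let G : EuclideanSpace ℝ (S × A) → S × A → ℝ := fun μ y =>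
    stateMarginal μ y.1 * φ (policyOf μ y.1 y.2)
  have hreg : ∀ μ, occReg h μ = ∑ y, G μ y := fun μ => by
    rw [occReg_eq hφ, Fintype.sum_prod_type]
    exact sum_congr rfl fun s _ => mul_sum _ _ _
  have hconv : ∀ t, 0 ≤ t → t ≤ 1 → ∀ y, G (ρ t) y ≤ (1 - t) * G μ y + t * G μ₀ y := by
    intro t h0 h1 y
    have h1' : 0 ≤ 1 - t := by linarith
    have hν := hpos μ hμ.1 y.1
    have hν₀ := hpos μ₀ h₀ y.1
    have hN0 := hpos _ (hρ t h0 h1) y.1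
    have hN : stateMarginal (ρ t) y.1 = (1 - t) * stateMarginal μ y.1
      + t * stateMarginal μ₀ y.1 := stateMarginal_combo _ _ _ _ _
    set N := stateMarginal (ρ t) y.1
    set ν := stateMarginal μ y.1
    set ν₀ := stateMarginal μ₀ y.1
    have hpol : policyOf (ρ t) y.1 y.2 = ((1 - t) * ν / N) * policyOf μ y.1 y.2
        + (t * ν₀ / N) * policyOf μ₀ y.1 y.2 := by
      rw [policyOf_eq hN0]
      simp only [ρ, PiLp.add_apply, PiLp.smul_apply, smul_eq_mul]
      rw [apply_eq_mul_policyOf hν, apply_eq_mul_policyOf hν₀]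
      ring
    have key := hk.convexOn.2 ((policyOf_mem_stdSimplex hμ.1.1 y.1).1 y.2)
      ((policyOf_mem_stdSimplex h₀.1 y.1).1 y.2)
      (show 0 ≤ (1 - t) * ν / N by positivity) (show 0 ≤ t * ν₀ / N by positivity)
      (by rw [← add_div, ← hN, div_self hN0.ne'])
    simp only [smul_eq_mul] at key
    rw [← hpol] at key
    refine (mul_le_mul_of_nonneg_left key hN0.le).trans (le_of_eq ?_)
    change _ = (1 - t) * (ν * φ (policyOf μ y.1 y.2)) + t * (ν₀ * φ (policyOf μ₀ y.1 y.2))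
    field_simp
  have hGx : ∀ t, 0 < t → t ≤ 1 → G (ρ t) x
      = t * (μ₀ x * (φ (t * μ₀ x / stateMarginal (ρ t) x.1)
        / (t * μ₀ x / stateMarginal (ρ t) x.1))) := by
    intro t h0 h1
    have hN0 := hpos _ (hρ t h0.le h1) x.1
    have hx1 := hp₀ x
    have : policyOf (ρ t) x.1 x.2 = t * μ₀ x / stateMarginal (ρ t) x.1 := by
      rw [policyOf_eq hN0]
      simp only [ρ, PiLp.add_apply, PiLp.smul_apply, smul_eq_mul, Prod.mk.eta, hx0]
      ring
    simp only [G, this]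
    field_simp
  -- Optimality along the segment `ρ`, with convexity for the other coordinates, bounds the
  -- difference quotient of the `x` term below by this `t`-independent constant. That quotient is
  -- `μ₀ x` times `φ z / z` with `z → 0⁺`, which tends to `-∞`.
  set c := inner ℝ r (μ₀ - μ) - ∑ y ∈ univ.erase x, (G μ₀ y - G μ y) with hc
  have hlow : ∀ t, 0 < t → t ≤ 1 → c ≤ μ₀ x * (φ (t * μ₀ x / stateMarginal (ρ t) x.1)
        / (t * μ₀ x / stateMarginal (ρ t) x.1)) := by
    intro t h0 h1
    have h2 := hμ.2 _ (hρ t h0.le h1)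
    have hin : inner ℝ r (ρ t) = inner ℝ r μ + t * inner ℝ r (μ₀ - μ) := by
      simp only [ρ, inner_add_right, inner_smul_right, inner_sub_right]; ring
    rw [regObjective, regObjective, hin, hreg, hreg, ← add_sum_erase _ _ (mem_univ x),
      ← add_sum_erase univ (G μ) (mem_univ x), hGx t h0 h1] at h2
    have h3 : G μ x = 0 := by
      have : policyOf μ x.1 x.2 = 0 := by
        rw [policyOf_eq (hpos μ hμ.1 x.1), Prod.mk.eta, hx0, zero_div]
      simp only [G, this, hk.zero, mul_zero]
    have h4 : ∑ y ∈ univ.erase x, G (ρ t) y ≤ ∑ y ∈ univ.erase x, G μ y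
        + t * ∑ y ∈ univ.erase x, (G μ₀ y - G μ y) := by
      rw [mul_sum, ← sum_add_distrib]
      exact sum_le_sum fun y _ => (hconv t h0.le h1 y).trans (le_of_eq (by ring))
    refine le_of_mul_le_mul_left ?_ h0
    rw [hc]
    linarith
  have hstate : Filter.Tendsto (fun t => t * μ₀ x / stateMarginal (ρ t) x.1) (𝓝[>] 0)
      (𝓝[>] 0) := by
    refine tendsto_nhdsWithin_iff.2 ⟨?_, ?_⟩
    · have hcont : ContinuousAt (fun t => t * μ₀ x / stateMarginal (ρ t) x.1) 0 := by
        refine ContinuousAt.div (by fun_prop) ?_ (hpos _ (hρ 0 le_rfl zero_le_one) x.1).ne'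
        exact ((contDiff_stateMarginal (n := 0) x.1).continuous.comp
          (by fun_prop : Continuous ρ)).continuousAt
      have := hcont.tendsto.mono_left (nhdsWithin_le_nhds (s := Set.Ioi 0))
      simpa using this
    · filter_upwards [Ioc_mem_nhdsGT one_pos] with t ht
      exact div_pos (mul_pos ht.1 (hp₀ x)) (hpos _ (hρ t ht.1.le ht.2) x.1)
  have hbot := (hk.tendsto_div.comp hstate).const_mul_atBot (hp₀ x)
  have hev := (hbot.eventually_lt_atBot c).and
    (Filter.eventually_of_mem (Ioc_mem_nhdsGT one_pos) fun t ht => ht)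
  obtain ⟨t, h1, h2⟩ := hev.exists
  exact absurd (hlow t h2.1 h2.2) (not_le.2 h1)

end MDPModel

/-! ### Suboptimality bound and dual strong convexity. -/

namespace MDPModel

variable {S A : Type*} [Fintype S] [Fintype A] {m : MDPModel S A}
  {μ μ' : EuclideanSpace ℝ (S × A)} {φ φ' K : ℝ → ℝ} {h : (A → ℝ) → ℝ} {νmin : ℝ}

theorem abs_apply_le_rewardBound {rewards : Set (EuclideanSpace ℝ (S × A))}
    (hc : IsCompact rewards) {r : EuclideanSpace ℝ (S × A)} (hr : r ∈ rewards) (x : S × A) :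
    |r x| ≤ rewardBound rewards := by
  have hb : BddAbove ((fun r : EuclideanSpace ℝ (S × A) => ‖(WithLp.ofLp r : S × A → ℝ)‖)
      '' rewards) :=
    (hc.image ((PiLp.continuous_ofLp 2 _).norm)).bddAbove
  exact (norm_le_pi_norm (WithLp.ofLp r) x).trans (le_csSup hb ⟨r, hr, rfl⟩)

theorem rewardBound_nonneg (rewards : Set (EuclideanSpace ℝ (S × A))) :
    0 ≤ rewardBound rewards :=
  Real.sSup_nonneg (by rintro _ ⟨r, _, rfl⟩; exact norm_nonneg _)

/-- Suboptimality for the reward `r'` of an occupancy measure which is optimal for `r` and whose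
policy is bounded below. -/
theorem quotDist_sq_le_regObjective_sub [Nonempty A] (hφ : Generates φ h)
    (hk : IsSeparableKernel φ φ' K) (hνmin : 0 < νmin)
    (hν : ∀ μ ∈ m.occ, ∀ s, νmin ≤ stateMarginal μ s)
    {δ : ℝ} (hδ : 0 < δ) (hπ : ∀ s a, δ ≤ policyOf μ s a)
    {r r' : EuclideanSpace ℝ (S × A)} (hμ : μ ∈ m.optOcc h r) {D τ κ : ℝ}
    (hD : ‖r - r'‖ ≤ D) (hτ : 0 < τ) (hτD : τ < D) (hκ : 0 < κ) (hκδ : κ ≤ δ)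
    (hK : K δ ≤ τ / κ) :
    ∃ ρ ∈ m.occ, regObjective h r' μ
      + νmin * κ / (4 * (Fintype.card A) * D) * m.quotDist r r' ^ 2 ≤ regObjective h r' ρ := by
  set w := r' - r with hw
  set g := occGrad φ φ' μ with hg
  have hrg : r - g ∈ m.shaping := sub_occGrad_mem_shaping hφ hk hνmin hν hδ hπ hμ
  set d := m.shapingᗮ.starProjection w with hd
  have hdmem : d ∈ m.shapingᗮ := Submodule.starProjection_apply_mem _ _
  have hwd : w - d ∈ m.shaping := by
    have := Submodule.sub_starProjection_mem_orthogonal (K := m.shapingᗮ) w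
    rwa [Submodule.orthogonal_orthogonal] at this
  have hdD : ‖d‖ ≤ D := by
    refine le_trans ?_ ((norm_sub_rev r r').symm.trans_le hD)
    exact Submodule.norm_starProjection_apply_le _ _
  -- Stationarity for `r` makes `r - g` orthogonal to `d`, so only the reward change contributes.
  have hin : inner ℝ (r' - g) d = ‖d‖ ^ 2 := by
    have h1 : inner ℝ (w - d) d = 0 := Submodule.inner_right_of_mem_orthogonal hwd hdmem
    have h2 : inner ℝ (r - g) d = 0 := Submodule.inner_right_of_mem_orthogonal hrg hdmem
    rw [inner_sub_left, real_inner_self_eq_norm_sq] at h1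
    rw [show r' - g = w + (r - g) by rw [hw]; abel, inner_add_left, h2]
    linarith
  have hq : m.quotDist r r' ≤ ‖d‖ := by
    have h1 : m.shaping.mkQ r - m.shaping.mkQ r' = m.shaping.mkQ (-d) := by
      rw [← map_sub, Submodule.mkQ_apply, Submodule.mkQ_apply, Submodule.Quotient.eq]
      have : r - r' - -d = -(w - d) := by rw [hw]; abel
      rw [this]
      exact m.shaping.neg_mem hwd
    rw [quotDist, h1, ← norm_neg d]
    exact Submodule.Quotient.norm_mk_le _ _
  have hq0 : 0 ≤ m.quotDist r r' := norm_nonneg _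
  have hcard : (1 : ℝ) ≤ Fintype.card A := by exact_mod_cast Fintype.card_pos
  set c : ℝ := (Fintype.card A : ℝ) with hc
  have hD0 : 0 < D := hτ.trans hτD
  -- With `K δ ≤ τ / κ` and `τ < D`, this step makes the second-order loss at most half the gain; `κ
  -- ≤ δ` and `‖d‖ ≤ D` make it feasible.
  set ε := νmin * κ / (2 * c * D) with hε
  have hε0 : 0 < ε := by positivity
  have hεd : ε * ‖d‖ ≤ νmin * δ := by
    calc ε * ‖d‖ ≤ ε * D := mul_le_mul_of_nonneg_left hdD hε0.le
      _ = νmin * κ / (2 * c) := by rw [hε]; field_simp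
      _ ≤ νmin * κ := div_le_self (by positivity) (by linarith)
      _ ≤ νmin * δ := mul_le_mul_of_nonneg_left hκδ hνmin.le
  have hmem := add_smul_mem_occ hν hνmin hμ.1 hδ hπ hdmem hε0.le hεd
  refine ⟨_, hmem, le_trans ?_ (regObjective_add_smul_ge hφ hk hνmin hν hμ.1 hδ hπ r' hmem)⟩
  rw [hin]
  have hCε : K δ * c / νmin * ε ≤ 1 / 2 := by
    calc K δ * c / νmin * ε ≤ τ / κ * c / νmin * ε := by gcongr
      _ = τ / (2 * D) := by rw [hε]; field_simp
      _ ≤ 1 / 2 := by rw [div_le_div_iff₀ (by positivity) two_pos]; linarith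
  have h1 : K δ * c / νmin * (ε ^ 2 * ‖d‖ ^ 2) ≤ 1 / 2 * (ε * ‖d‖ ^ 2) := by
    have := mul_le_mul_of_nonneg_right hCε (show 0 ≤ ε * ‖d‖ ^ 2 by positivity)
    linarith
  have h2 : νmin * κ / (4 * c * D) * m.quotDist r r' ^ 2 ≤ 1 / 2 * (ε * ‖d‖ ^ 2) := by
    have e : νmin * κ / (4 * c * D) = 1 / 2 * ε := by rw [hε]; field_simp; norm_num
    rw [e, mul_assoc]
    gcongr
  linarith

theorem isDualConstant_of_kernel [Nonempty A] [Nonempty S] (hφ : Generates φ h)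
    (hk : IsSeparableKernel φ φ' K) {c : ℝ} (hc : 0 < c) (hsc : SimplexStrongConvex A φ c)
    (hνmin : 0 < νmin) (hν : ∀ μ ∈ m.occ, ∀ s, νmin ≤ stateMarginal μ s)
    {B : ℝ} (hh0 : ∀ p ∈ stdSimplex ℝ A, ∑ a, φ (p a) ≤ 0)
    (hhB : ∀ p ∈ stdSimplex ℝ A, -B ≤ ∑ a, φ (p a))
    {rewards : Set (EuclideanSpace ℝ (S × A))} (hrewards : IsCompact rewards)
    {D τ κ δ σ : ℝ} (hD : D = Metric.diam rewards) (hτ : 0 < τ) (hτD : τ < D)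
    (hδ : ∀ p ∈ stdSimplex ℝ A, (∀ a, 0 < p a) → ∀ a,
      -((2 * rewardBound rewards + B) * m.horizon)
        ≤ φ' (p a) + ∑ b, φ (p b) - ∑ b, φ' (p b) * p b → δ ≤ p a)
    (hκ : 0 < κ) (hκδ : κ ≤ δ) (hK : K δ ≤ τ / κ)
    (hσ : σ ≤ νmin * κ / (2 * (Fintype.card A) * D)) :
    m.IsDualConstant h rewards σ := by
  have hp : ∀ μ ∈ m.occ, ∀ s, 0 < stateMarginal μ s := fun μ hμ s => hνmin.trans_le (hν μ hμ s)
  have hη : 0 < c * νmin / m.horizon ^ 2 := by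
    have := m.horizon_pos
    positivity
  have hf := strongConvexOn_occReg hφ hc.le hsc hνmin hν
  have hcont := continuousOn_occReg hφ hk hp
  have hexists : ∀ r, ∃ μ, μ ∈ m.optOcc h r := fun r => by
    obtain ⟨μ₀, h₀, -⟩ := m.exists_pos_mem_occ hp
    obtain ⟨μ, hμ, hmax⟩ := m.isCompact_occ.exists_isMaxOn ⟨μ₀, h₀⟩
      ((continuous_const.inner continuous_id).continuousOn.sub hcont :
        ContinuousOn (fun z => inner ℝ r z - occReg h z) m.occ)
    exact ⟨μ, hμ, fun z hz => hmax hz⟩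
  have hgrad : ∀ r, ∀ μ ∈ m.optOcc h r, HasGradientAt (m.conj h) μ r := fun r μ hμ =>
    hf.hasGradientAt_conjugate hη m.isCompact_occ hcont hμ.1 hμ.2
  have hconj : ∀ r, ∀ μ ∈ m.optOcc h r, m.conj h r = regObjective h r μ := fun r μ hμ =>
    sSup_image_eq_of_isMax hμ.1 hμ.2
  have hkey : ∀ r ∈ rewards, ∀ r' ∈ rewards, ∀ μ ∈ m.optOcc h r,
      σ / 2 * m.quotDist r r' ^ 2 ≤ m.conj h r' - regObjective h r' μ := by
    intro r hr r' hr' μ hμ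
    have hπ0 : ∀ s a, 0 < policyOf μ s a := fun s a => by
      rw [policyOf_eq (hp μ hμ.1 s)]
      exact div_pos (pos_of_mem_optOcc hφ hk hp hμ _) (hp μ hμ.1 s)
    -- Bootstrapping: the minimum of the policy is a positive but uncontrolled lower bound, enough
    -- for stationarity; stationarity then yields the explicit `δ`.
    obtain ⟨y, hy⟩ := Finite.exists_min (fun x : S × A => policyOf μ x.1 x.2)
    have hmem := sub_occGrad_mem_shaping hφ hk hνmin hν (hπ0 y.1 y.2) (fun s a => hy (s, a)) hμ
    have hδμ : ∀ s a, δ ≤ policyOf μ s a := fun s a =>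
      hδ _ (policyOf_mem_stdSimplex hμ.1.1 s) (hπ0 s) a
        (occGrad_ge hh0 hhB hμ.1.1
          (abs_apply_le_rewardBound hrewards hr) hmem (s, a))
    have hdist : ‖r - r'‖ ≤ D := by
      rw [hD, ← dist_eq_norm]
      exact Metric.dist_le_diam_of_mem hrewards.isBounded hr hr'
    obtain ⟨ρ, hρ, hle⟩ := quotDist_sq_le_regObjective_sub hφ hk hνmin hν (hκ.trans_le hκδ) hδμ hμ
      hdist hτ hτD hκ hκδ hK
    obtain ⟨μ', hμ'⟩ := hexists r'
    rw [hconj r' μ' hμ']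
    have h1 := hμ'.2 ρ hρ
    have hD0 := hτ.trans hτD
    have h2 : σ / 2 ≤ νmin * κ / (4 * (Fintype.card A) * D) := by
      have e : νmin * κ / (4 * (Fintype.card A) * D)
          = νmin * κ / (2 * (Fintype.card A) * D) / 2 := by ring
      rw [e]; linarith
    have h3 := mul_le_mul_of_nonneg_right h2 (sq_nonneg (m.quotDist r r'))
    linarith
  refine ⟨fun r _ => ?_, fun r hr r' hr' => ?_, fun r hr => ?_⟩
  · obtain ⟨μ, hμ⟩ := hexists r
    exact (hgrad r μ hμ).differentiableAt
  · obtain ⟨μ, hμ⟩ := hexists r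
    have h1 := hkey r hr r' hr' μ hμ
    have h2 : m.quotDist r' r = m.quotDist r r' := norm_sub_rev _ _
    rw [(hgrad r μ hμ).gradient, hconj r μ hμ, h2, real_inner_comm, inner_sub_left]
    rw [regObjective] at h1 ⊢
    linarith
  · obtain ⟨μ, hμ⟩ := hexists r
    refine ⟨μ, Set.eq_singleton_iff_unique_mem.2 ⟨hμ, fun μ' hμ' =>
      hf.eq_of_isMax hη hμ.1 hμ.2 hμ'.1 hμ'.2⟩, fun r' hr' => hkey r hr r' hr' μ hμ⟩

end MDPModel

/-! ### Pinsker's inequality. -/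

/-- The difference has derivative `(t - 1)³ / (t² (t + 2)²)`, so its minimum is at `t = 1`, where it
vanishes. The rational function is the one that produces the weights `x + 2u` in `mul_log_sub_ge`.
-/
theorem log_ge_of_pos {t : ℝ} (ht : 0 < t) :
    (t - 1) * (5 * t + 1) / (2 * t * (t + 2)) ≤ Real.log t := by
  let f : ℝ → ℝ := fun t => Real.log t - (t - 1) * (5 * t + 1) / (2 * t * (t + 2))
  have hder : ∀ t, 0 < t → HasDerivAt f ((t - 1) ^ 3 / (t ^ 2 * (t + 2) ^ 2)) t := by
    intro t ht
    have h1 : HasDerivAt (fun t : ℝ => (t - 1) * (5 * t + 1)) (1 * (5 * t + 1) + (t - 1) * 5) t := by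
      have h5 : HasDerivAt (fun t : ℝ => 5 * t + 1) 5 t := by
        simpa using ((hasDerivAt_id t).const_mul 5).add_const 1
      exact ((hasDerivAt_id t).sub_const 1).mul h5
    have h2 : HasDerivAt (fun t : ℝ => 2 * t * (t + 2)) (2 * (t + 2) + 2 * t * 1) t := by
      have h5 : HasDerivAt (fun t : ℝ => 2 * t) 2 t := by
        simpa using (hasDerivAt_id t).const_mul 2
      exact h5.mul ((hasDerivAt_id t).add_const 2)
    refine ((Real.hasDerivAt_log ht.ne').sub (h1.div h2 (by positivity))).congr_deriv ?_
    have : t + 2 ≠ 0 := by positivity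
    field_simp
    ring
  have hf1 : f 1 = 0 := by simp [f]
  suffices 0 ≤ f t by simpa [f] using this
  rw [← hf1]
  rcases le_total t 1 with h | h
  · refine antitoneOn_of_deriv_nonpos (convex_Icc t 1)
      (fun x hx => (hder x (ht.trans_le hx.1)).continuousAt.continuousWithinAt)
      (fun x hx => ?_) (fun x hx => ?_) ⟨le_rfl, h⟩ ⟨h, le_rfl⟩ h
    · rw [interior_Icc] at hx
      exact (hder x (ht.trans hx.1)).differentiableAt.differentiableWithinAt
    · rw [interior_Icc] at hx
      rw [(hder x (ht.trans hx.1)).deriv]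
      refine div_nonpos_of_nonpos_of_nonneg ?_ (by positivity)
      have h2 : x - 1 ≤ 0 := by linarith [hx.2]
      have : (x - 1) ^ 3 = (x - 1) ^ 2 * (x - 1) := by ring
      rw [this]
      exact mul_nonpos_of_nonneg_of_nonpos (sq_nonneg _) h2
  · refine monotoneOn_of_deriv_nonneg (convex_Icc 1 t)
      (fun x hx => (hder x (one_pos.trans_le hx.1)).continuousAt.continuousWithinAt)
      (fun x hx => ?_) (fun x hx => ?_) ⟨le_rfl, h⟩ ⟨h, le_rfl⟩ h
    · rw [interior_Icc] at hx
      exact (hder x (one_pos.trans hx.1)).differentiableAt.differentiableWithinAt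
    · rw [interior_Icc] at hx
      rw [(hder x (one_pos.trans hx.1)).deriv]
      have h2 : 0 ≤ x - 1 := by linarith [hx.1]
      positivity

theorem mul_log_sub_ge {x u : ℝ} (hx : 0 ≤ x) (hu : 0 ≤ u) (h0 : u = 0 → x = 0) :
    3 / 2 * ((x - u) ^ 2 / (x + 2 * u)) ≤ x * Real.log x - x * Real.log u - x + u := by
  rcases hu.eq_or_lt with rfl | hu
  · simp [h0 rfl]
  rcases hx.eq_or_lt with rfl | hx
  · have : (0 - u) ^ 2 / (0 + 2 * u) = u / 2 := by field_simp; ring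
    rw [this]; simp; linarith
  have h1 := mul_le_mul_of_nonneg_left (log_ge_of_pos (div_pos hx hu)) hx.le
  rw [Real.log_div hx.ne' hu.ne'] at h1
  have h2 : x * ((x / u - 1) * (5 * (x / u) + 1) / (2 * (x / u) * (x / u + 2)))
      = 3 / 2 * ((x - u) ^ 2 / (x + 2 * u)) + x - u := by
    field_simp
    ring
  linarith

/-- Pinsker's inequality on a finite set. -/
theorem pinsker {A : Type*} [Fintype A] {p u : A → ℝ} (hp : p ∈ stdSimplex ℝ A)
    (hu : u ∈ stdSimplex ℝ A) (h0 : ∀ a, u a = 0 → p a = 0) :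
    1 / 2 * (∑ a, |p a - u a|) ^ 2 ≤ ∑ a, (p a * Real.log (p a) - p a * Real.log (u a)) := by
  have h1 : ∑ a, 3 / 2 * ((p a - u a) ^ 2 / (p a + 2 * u a))
      ≤ ∑ a, (p a * Real.log (p a) - p a * Real.log (u a) - p a + u a) :=
    sum_le_sum fun a _ => mul_log_sub_ge (hp.1 a) (hu.1 a) (h0 a)
  -- Cauchy–Schwarz with weights `p + 2u`, whose total mass `3` cancels the constant `3 / 2` down to
  -- `1 / 2`.
  have h2 : (∑ a, |p a - u a|) ^ 2
      ≤ (∑ a, (p a - u a) ^ 2 / (p a + 2 * u a)) * ∑ a, (p a + 2 * u a) := by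
    refine sum_sq_le_sum_mul_sum_of_sq_le_mul _ (fun a _ => ?_) (fun a _ => ?_) (fun a _ => ?_)
    · exact div_nonneg (sq_nonneg _) (by linarith [hp.1 a, hu.1 a])
    · linarith [hp.1 a, hu.1 a]
    · rw [sq_abs]
      rcases eq_or_ne (p a + 2 * u a) 0 with h | h
      · have h3 : p a = 0 := by linarith [hp.1 a, hu.1 a]
        have h4 : u a = 0 := by linarith [hp.1 a, hu.1 a]
        simp [h3, h4]
      · exact (div_mul_cancel₀ _ h).ge
  have h3 : ∑ a, (p a + 2 * u a) = 3 := by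
    rw [sum_add_distrib, ← mul_sum, hp.2, hu.2]; norm_num
  have h4 : ∑ a, (p a * Real.log (p a) - p a * Real.log (u a) - p a + u a)
      = ∑ a, (p a * Real.log (p a) - p a * Real.log (u a)) := by
    rw [sum_add_distrib, sum_sub_distrib, hp.2, hu.2]; ring
  rw [h3] at h2
  rw [h4, ← mul_sum] at h1
  linarith

/-! ### The Shannon regularizer. -/

section Shannon

variable {A : Type*} [Fintype A] {τ : ℝ}

theorem generates_shannon (τ : ℝ) :
    Generates (A := A) (fun x => τ * (x * Real.log x)) (shannonRegularizer τ) := by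
  intro p _
  rw [shannonRegularizer, shannonEntropy, ← mul_sum]
  ring

theorem isSeparableKernel_shannon (hτ : 0 < τ) :
    IsSeparableKernel (fun x => τ * (x * Real.log x)) (fun x => τ * (Real.log x + 1))
      (fun δ => τ / δ) where
  continuous := Real.continuous_mul_log.const_mul τ
  contDiffAt x hx := contDiffAt_const.mul (contDiffAt_id.mul (Real.contDiffAt_log.2 hx.ne'))
  convexOn := Real.convexOn_mul_log.smul hτ.le
  zero := by simp
  tendsto_div := by
    refine (Real.tendsto_log_nhdsGT_zero.const_mul_atBot hτ).congr' ?_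
    filter_upwards [self_mem_nhdsWithin] with x hx
    have : x ≠ 0 := (Set.mem_Ioi.1 hx).ne'
    field_simp
  K_pos δ hδ := by positivity
  bregman_le δ hδ x hx y hy := by
    have hx0 : 0 < x := hδ.trans_le hx
    have h1 : τ / x * (y - x) ^ 2 ≤ τ / δ * (y - x) ^ 2 := by gcongr
    refine le_trans ?_ h1
    have h2 : y * Real.log y - y * Real.log x ≤ y * (y / x - 1) := by
      rcases hy.eq_or_lt with rfl | hy
      · simp
      rw [← mul_sub, ← Real.log_div hy.ne' hx0.ne']
      exact mul_le_mul_of_nonneg_left (Real.log_le_sub_one_of_pos (div_pos hy hx0)) hy.le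
    have h3 : τ / x * (y - x) ^ 2 = τ * (y * (y / x - 1) - y + x) := by field_simp; ring
    rw [h3]
    calc _ = τ * (y * Real.log y - y * Real.log x - y + x) := by ring
      _ ≤ _ := by gcongr

/-- The Jensen gap equals `τ` times `a KL(p, u) + b KL(q, u)` at the mixture `u`. Pinsker applies to
each term, and `a b² + b a² = a b`. -/
theorem simplexStrongConvex_shannon (hτ : 0 < τ) :
    SimplexStrongConvex A (fun x => τ * (x * Real.log x)) τ := by
  intro p hp q hq a b ha hb hab
  rcases ha.eq_or_lt with rfl | ha
  · have : b = 1 := by linarith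
    simp [this]
  rcases hb.eq_or_lt with rfl | hb
  · have : a = 1 := by linarith
    simp [this]
  set u : A → ℝ := fun i => a * p i + b * q i with hu
  have hmem : u ∈ stdSimplex ℝ A := convex_stdSimplex ℝ A hp hq ha.le hb.le hab
  have h0 : ∀ i, u i = 0 → p i = 0 ∧ q i = 0 := by
    intro i hi
    have h1 := mul_nonneg ha.le (hp.1 i)
    have h2 := mul_nonneg hb.le (hq.1 i)
    have h3 : a * p i = 0 := by simp only [hu] at hi; linarith
    have h4 : b * q i = 0 := by simp only [hu] at hi; linarith
    exact ⟨(mul_eq_zero.1 h3).resolve_left ha.ne', (mul_eq_zero.1 h4).resolve_left hb.ne'⟩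
  have hP := mul_le_mul_of_nonneg_left (pinsker hp hmem fun i hi => (h0 i hi).1) ha.le
  have hQ := mul_le_mul_of_nonneg_left (pinsker hq hmem fun i hi => (h0 i hi).2) hb.le
  have e1 : ∑ i, |p i - u i| = b * ∑ i, |p i - q i| := by
    rw [mul_sum]
    refine sum_congr rfl fun i _ => ?_
    have e : p i - u i = b * (p i - q i) := by
      simp only [hu]
      linear_combination -(p i) * hab
    rw [e, abs_mul, abs_of_pos hb]
  have e2 : ∑ i, |q i - u i| = a * ∑ i, |p i - q i| := by
    rw [mul_sum]
    refine sum_congr rfl fun i _ => ?_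
    have e : q i - u i = -(a * (p i - q i)) := by
      simp only [hu]
      linear_combination -(q i) * hab
    rw [e, abs_neg, abs_mul, abs_of_pos ha]
  rw [e1] at hP
  rw [e2] at hQ
  have e3 : a * ∑ i, (p i * Real.log (p i) - p i * Real.log (u i))
      + b * ∑ i, (q i * Real.log (q i) - q i * Real.log (u i))
      = a * ∑ i, p i * Real.log (p i) + b * ∑ i, q i * Real.log (q i)
        - ∑ i, u i * Real.log (u i) := by
    simp only [mul_sum]
    rw [← sum_add_distrib, ← sum_add_distrib, ← sum_sub_distrib]
    refine sum_congr rfl fun i _ => ?_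
    simp only [hu]
    ring
  set X := ∑ i, |p i - q i|
  have e4 : a * (1 / 2 * (b * X) ^ 2) + b * (1 / 2 * (a * X) ^ 2) = 1 / 2 * (a * b) * X ^ 2 := by
    linear_combination (1 / 2 * (a * b) * X ^ 2) * hab
  have h5 : 1 / 2 * (a * b) * X ^ 2 ≤ a * ∑ i, p i * Real.log (p i)
      + b * ∑ i, q i * Real.log (q i) - ∑ i, u i * Real.log (u i) := by linarith
  have h6 := mul_le_mul_of_nonneg_left h5 hτ.le
  simp only [← mul_sum]
  linarith

theorem sum_shannon_nonpos (hτ : 0 < τ) {p : A → ℝ} (hp : p ∈ stdSimplex ℝ A) :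
    ∑ a, τ * (p a * Real.log (p a)) ≤ 0 :=
  sum_nonpos fun a _ => mul_nonpos_of_nonneg_of_nonpos hτ.le
    (Real.mul_log_nonpos (hp.1 a) (by
      rw [← hp.2]; exact single_le_sum (fun i _ => hp.1 i) (mem_univ a)))

theorem sum_shannon_ge [Nonempty A] (hτ : 0 < τ) {p : A → ℝ} (hp : p ∈ stdSimplex ℝ A) :
    -(τ * Real.log (Fintype.card A)) ≤ ∑ a, τ * (p a * Real.log (p a)) := by
  have hc : (0 : ℝ) < Fintype.card A := by exact_mod_cast Fintype.card_pos
  rw [← mul_sum, ← mul_neg]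
  refine mul_le_mul_of_nonneg_left ?_ hτ.le
  set c : ℝ := (Fintype.card A : ℝ) with hcdef
  have h1 : ∀ a, -(p a * Real.log c) + p a - 1 / c ≤ p a * Real.log (p a) := by
    intro a
    rcases (hp.1 a).eq_or_lt with h | h
    · rw [← h]; simp; positivity
    have h2 := mul_le_mul_of_nonneg_left
      (Real.log_le_sub_one_of_pos (show 0 < 1 / (p a * c) by positivity)) h.le
    rw [one_div, Real.log_inv, Real.log_mul h.ne' hc.ne'] at h2
    have h3 : p a * ((p a * c)⁻¹ - 1) = 1 / c - p a := by field_simp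
    linarith
  have h2 := sum_le_sum fun a (_ : a ∈ univ) => h1 a
  rw [sum_sub_distrib, sum_add_distrib, sum_neg_distrib, ← sum_mul, hp.2, sum_const, card_univ,
    nsmul_eq_mul, ← hcdef, mul_one_div_cancel hc.ne'] at h2
  linarith

/-- The entropy terms in the gradient cancel exactly, leaving `τ log (p a)`; exponentiating gives
the bound. -/
theorem shannon_policy_ge (hτ : 0 < τ) {R H c : ℝ} (hc : 0 < c) {p : A → ℝ}
    (hp : p ∈ stdSimplex ℝ A) (hpos : ∀ a, 0 < p a) (a : A)
    (h : -((2 * R + τ * Real.log c) * H) ≤ τ * (Real.log (p a) + 1)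
      + ∑ b, τ * (p b * Real.log (p b)) - ∑ b, τ * (Real.log (p b) + 1) * p b) :
    Real.exp (-2 * R * H / τ) * c ^ (-H) ≤ p a := by
  have e : ∑ b, τ * (Real.log (p b) + 1) * p b = ∑ b, τ * (p b * Real.log (p b)) + τ := by
    have e1 : ∑ b, τ * p b = τ := by rw [← mul_sum, hp.2, mul_one]
    conv_rhs => rw [← e1]
    rw [← sum_add_distrib]
    exact sum_congr rfl fun b _ => by rw [e1]; ring
  rw [e] at h
  rw [Real.rpow_def_of_pos hc, ← Real.exp_add, ← Real.le_log_iff_exp_le (hpos a)]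
  rw [← mul_le_mul_iff_right₀ hτ]
  have : τ * (-2 * R * H / τ + Real.log c * -H) = -((2 * R + τ * Real.log c) * H) := by
    field_simp; ring
  rw [this]
  linarith

end Shannon

/-! ### The Tsallis-1/2 regularizer. -/

section Tsallis

variable {A : Type*} [Fintype A] {τ : ℝ}

/-- The linear term `2 τ x` absorbs the additive constant of the regularizer, using that `p` sums to
one. -/
theorem generates_tsallis (τ : ℝ) :
    Generates (A := A) (fun x => 2 * τ * (x - √x)) (tsallisRegularizer τ) := by
  intro p hp
  simp only [tsallisRegularizer, tsallisEntropy, ← mul_sum, sum_sub_distrib, hp, Real.sqrt_eq_rpow]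
  norm_num
  ring

theorem isSeparableKernel_tsallis (hτ : 0 < τ) :
    IsSeparableKernel (fun x => 2 * τ * (x - √x)) (fun x => 2 * τ - τ / √x)
      (fun δ => τ / (δ * √δ)) where
  continuous := by fun_prop
  contDiffAt x hx := contDiffAt_const.mul (contDiffAt_id.sub (Real.contDiffAt_sqrt hx.ne'))
  convexOn := ((convexOn_id (convex_Ici 0)).sub Real.strictConcaveOn_sqrt.concaveOn).smul
    (by positivity)
  zero := by simp
  tendsto_div := by
    have h1 : Filter.Tendsto (fun x : ℝ => √x) (𝓝[>] 0) (𝓝[>] 0) := by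
      refine tendsto_nhdsWithin_iff.2 ⟨?_, ?_⟩
      · simpa using (Real.continuous_sqrt.tendsto 0).mono_left nhdsWithin_le_nhds
      · filter_upwards [self_mem_nhdsWithin] with x hx using Real.sqrt_pos.2 hx
    have h2 := Filter.tendsto_atBot_add_const_left (𝓝[>] (0 : ℝ)) (1 : ℝ)
      (Filter.tendsto_neg_atTop_atBot.comp (tendsto_inv_nhdsGT_zero.comp h1))
    refine (h2.const_mul_atBot (show 0 < 2 * τ by positivity)).congr' ?_
    filter_upwards [self_mem_nhdsWithin] with x hx
    have hx0 : 0 < x := hx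
    have hs : 0 < √x := Real.sqrt_pos.2 hx0
    simp only [Function.comp]
    have e := Real.sq_sqrt hx0.le
    set s := √x
    rw [← e]
    field_simp
    ring
  K_pos δ hδ := by positivity
  bregman_le δ hδ x hx y hy := by
    have hx0 : 0 < x := hδ.trans_le hx
    have ha : 0 < √x := Real.sqrt_pos.2 hx0
    have hb : 0 ≤ √y := Real.sqrt_nonneg y
    have h1 : τ / (x * √x) * (y - x) ^ 2 ≤ τ / (δ * √δ) * (y - x) ^ 2 := by gcongr
    refine le_trans ?_ h1
    have ex := Real.sq_sqrt hx0.le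
    have ey := Real.sq_sqrt hy
    set a := √x
    set b := √y
    rw [← ex, ← ey]
    -- In square-root coordinates the divergence is exactly `τ (b - a)² / a`.
    have e1 : 2 * τ * (b ^ 2 - b) - 2 * τ * (a ^ 2 - a) - (2 * τ - τ / a) * (b ^ 2 - a ^ 2)
        = τ / (a ^ 2 * a) * ((b - a) ^ 2 * a ^ 2) := by field_simp; ring
    have e2 : (b ^ 2 - a ^ 2) ^ 2 = (b - a) ^ 2 * (b + a) ^ 2 := by ring
    rw [e1, e2]
    have : a ≤ b + a := by linarith
    gcongr

/-- With `u = √x`, `v = √y`, `L = a u + b v` and `w` the right side, `w² - L² = a b (u - v)²`. The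
constant `1 / 8` comes from `w + L ≤ 2` and `(u + v)² ≤ 4`. -/
theorem sqrt_combo_ge {x y a b : ℝ} (hx : 0 ≤ x) (hx1 : x ≤ 1) (hy : 0 ≤ y) (hy1 : y ≤ 1)
    (ha : 0 ≤ a) (hb : 0 ≤ b) (hab : a + b = 1) :
    a * √x + b * √y + 1 / 8 * (a * b) * (x - y) ^ 2 ≤ √(a * x + b * y) := by
  have ex := Real.sq_sqrt hx
  have ey := Real.sq_sqrt hy
  have hu := Real.sqrt_nonneg x
  have hv := Real.sqrt_nonneg y
  have hu1 : √x ≤ 1 := Real.sqrt_le_one.2 hx1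
  have hv1 : √y ≤ 1 := Real.sqrt_le_one.2 hy1
  set u := √x
  set v := √y
  have hm0 : 0 ≤ a * x + b * y := by positivity
  have hm1 : a * x + b * y ≤ 1 := by nlinarith
  have em := Real.sq_sqrt hm0
  have hw := Real.sqrt_nonneg (a * x + b * y)
  have hw1 : √(a * x + b * y) ≤ 1 := Real.sqrt_le_one.2 hm1
  set w := √(a * x + b * y)
  set L := a * u + b * v with hL
  have hL0 : 0 ≤ L := by positivity
  have hL1 : L ≤ 1 := by nlinarith
  have h1 : w ^ 2 - L ^ 2 = a * b * (u - v) ^ 2 := by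
    have hb' : b = 1 - a := by linarith
    rw [em, hL, ← ex, ← ey, hb']; ring
  have h2 : 0 ≤ a * b := by positivity
  have hLw : L ≤ w := by
    refine abs_le_of_sq_le_sq' ?_ hw |>.2
    nlinarith [mul_nonneg h2 (sq_nonneg (u - v))]
  have h3 : (x - y) ^ 2 ≤ 4 * (u - v) ^ 2 := by
    have e : (x - y) ^ 2 = (u + v) ^ 2 * (u - v) ^ 2 := by rw [← ex, ← ey]; ring
    rw [e]
    refine mul_le_mul_of_nonneg_right ?_ (sq_nonneg _)
    nlinarith
  have h4 : w ^ 2 - L ^ 2 ≤ 2 * (w - L) := by nlinarith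
  nlinarith [mul_le_mul_of_nonneg_left h3 h2]

theorem simplexStrongConvex_tsallis [Nonempty A] (hτ : 0 < τ) :
    SimplexStrongConvex A (fun x => 2 * τ * (x - √x)) (τ / (2 * Fintype.card A)) := by
  intro p hp q hq a b ha hb hab
  have hle : ∀ p ∈ stdSimplex ℝ A, ∀ i, p i ≤ 1 := fun p hp i => by
    rw [← hp.2]; exact single_le_sum (fun i _ => hp.1 i) (mem_univ i)
  have hc : (0 : ℝ) < Fintype.card A := by exact_mod_cast Fintype.card_pos
  have h1 : (∑ i, |p i - q i|) ^ 2 ≤ (Fintype.card A : ℝ) * ∑ i, (p i - q i) ^ 2 := by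
    simpa using sq_sum_le_card_mul_sum_sq (s := univ) (f := fun i => |p i - q i|)
  have h2 : τ / (2 * Fintype.card A) / 2 * (a * b) * (∑ i, |p i - q i|) ^ 2
      ≤ τ / 4 * (a * b) * ∑ i, (p i - q i) ^ 2 := by
    calc _ ≤ τ / (2 * Fintype.card A) / 2 * (a * b) *
          ((Fintype.card A : ℝ) * ∑ i, (p i - q i) ^ 2) := by gcongr
      _ = _ := by field_simp; ring
  refine (add_le_add_right h2 _).trans ?_
  rw [mul_sum, mul_sum, mul_sum, ← sum_add_distrib, ← sum_add_distrib]
  refine sum_le_sum fun i _ => ?_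
  have h3 := mul_le_mul_of_nonneg_left (sqrt_combo_ge (hp.1 i) (hle p hp i) (hq.1 i) (hle q hq i)
    ha hb hab) (show 0 ≤ 2 * τ by positivity)
  linarith

theorem one_le_sum_sqrt {p : A → ℝ} (hp : p ∈ stdSimplex ℝ A) : 1 ≤ ∑ a, √(p a) := by
  rw [← hp.2]
  refine sum_le_sum fun a _ => ?_
  have : p a ≤ 1 := by rw [← hp.2]; exact single_le_sum (fun i _ => hp.1 i) (mem_univ a)
  refine Real.le_sqrt_of_sq_le ?_
  nlinarith [hp.1 a]

theorem sum_tsallis_nonpos (hτ : 0 < τ) {p : A → ℝ} (hp : p ∈ stdSimplex ℝ A) :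
    ∑ a, 2 * τ * (p a - √(p a)) ≤ 0 := by
  rw [← mul_sum, sum_sub_distrib, hp.2]
  exact mul_nonpos_of_nonneg_of_nonpos (by positivity) (by linarith [one_le_sum_sqrt hp])

theorem sum_tsallis_ge (hτ : 0 < τ) {p : A → ℝ} (hp : p ∈ stdSimplex ℝ A) :
    -(2 * τ * (√(Fintype.card A) - 1)) ≤ ∑ a, 2 * τ * (p a - √(p a)) := by
  rw [← mul_sum, sum_sub_distrib, hp.2, ← mul_neg]
  refine mul_le_mul_of_nonneg_left ?_ (by positivity)
  have h1 : (∑ a, √(p a)) ^ 2 ≤ (Fintype.card A : ℝ) * ∑ a, √(p a) ^ 2 := by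
    simpa using sq_sum_le_card_mul_sum_sq (s := univ) (f := fun a => √(p a))
  simp only [fun a => Real.sq_sqrt (hp.1 a)] at h1
  rw [hp.2, mul_one] at h1
  linarith [Real.le_sqrt_of_sq_le h1]

/-- The gradient reduces to `2τ - τ ∑ √p - τ / √(p a)`, and `∑ √p ≥ 1` gives an upper bound on `1 /
√(p a)`. The factor `3 c` is slack that absorbs the remaining constants. -/
theorem tsallis_policy_ge (hτ : 0 < τ) {R H c : ℝ} (hR : 0 ≤ R) (hH : 1 ≤ H) (hc : 1 ≤ c)
    {p : A → ℝ} (hp : p ∈ stdSimplex ℝ A) (hpos : ∀ a, 0 < p a) (a : A)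
    (h : -((2 * R + 2 * τ * (c - 1)) * H) ≤ 2 * τ - τ / √(p a)
      + ∑ b, 2 * τ * (p b - √(p b)) - ∑ b, (2 * τ - τ / √(p b)) * p b) :
    1 / ((2 * R / τ + 3 * c) * H) ^ 2 ≤ p a := by
  have e : ∑ b, (2 * τ - τ / √(p b)) * p b = 2 * τ - τ * ∑ b, √(p b) := by
    have e1 : ∑ b, 2 * τ * p b = 2 * τ := by rw [← mul_sum, hp.2, mul_one]
    conv_rhs => rw [← e1]
    rw [mul_sum, ← sum_sub_distrib]
    refine sum_congr rfl fun b _ => ?_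
    rw [sub_mul, div_mul_eq_mul_div, mul_div_assoc, Real.div_sqrt]
  rw [e, ← mul_sum, sum_sub_distrib, hp.2] at h
  have h1 := one_le_sum_sqrt hp
  have hs : 0 < √(p a) := Real.sqrt_pos.2 (hpos a)
  have h2 : τ / √(p a) ≤ τ * ((2 * R / τ + 3 * c) * H) := by
    have e2 : τ * ((2 * R / τ + 3 * c) * H) = 2 * R * H + 3 * τ * c * H := by field_simp
    rw [e2]
    nlinarith [mul_nonneg hτ.le (sub_nonneg.2 h1), mul_nonneg hτ.le (sub_nonneg.2 hH),
      mul_nonneg (mul_nonneg hτ.le (sub_nonneg.2 hc)) (by linarith : 0 ≤ H)]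
  have hB : 0 < (2 * R / τ + 3 * c) * H := by positivity
  set B := (2 * R / τ + 3 * c) * H
  rw [div_le_iff₀ hs, mul_assoc] at h2
  have h3 : 1 ≤ B * √(p a) := by
    refine le_of_mul_le_mul_left ?_ hτ
    linarith
  rw [div_le_iff₀ (by positivity)]
  calc (1 : ℝ) ≤ (B * √(p a)) ^ 2 := one_le_pow₀ h3
    _ = p a * B ^ 2 := by rw [mul_pow, Real.sq_sqrt (hpos a).le, mul_comm]

end Tsallis

end

theorem mainTheorem8 {S A : Type*} [Fintype S] [Fintype A] [Nontrivial S] [Nontrivial A]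
    (m : MDPModel S A)
    (νmin : ℝ) (hνmin : 0 < νmin) (hν : ∀ μ ∈ m.occ, ∀ s, νmin ≤ stateMarginal μ s)
    (rewards : Set (EuclideanSpace ℝ (S × A))) (hrewards : IsCompact rewards)
    (R D : ℝ) (hR : R = rewardBound rewards) (hD : D = Metric.diam rewards)
    (τ : ℝ) (hτ : 0 < τ) (hτD : τ < D) :
    (m.IsRegular (shannonRegularizer τ) (τ * νmin / m.horizon ^ 2) ∧
      m.IsDualConstant (shannonRegularizer τ) rewards
        (Real.exp (-2 * R * m.horizon / τ) * νmin /
          (2 * D * (Fintype.card S : ℝ) * (Fintype.card A : ℝ) ^ (2 + m.horizon)))) ∧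
    (m.IsRegular (tsallisRegularizer τ)
        (τ * νmin / (2 * m.horizon ^ 2 * (Fintype.card A : ℝ))) ∧
      m.IsDualConstant (tsallisRegularizer τ) rewards
        (νmin /
          (2 * Real.sqrt 2 * D * (Fintype.card S : ℝ) * (Fintype.card A : ℝ) *
            ((2 * R / τ + 3 * Real.sqrt (Fintype.card A : ℝ)) * m.horizon) ^ 3))) := by
  subst hR hD
  have hH0 := m.horizon_pos
  have hH1 : 1 ≤ m.horizon := by
    rw [MDPModel.horizon, le_div_iff₀ (by linarith [m.γ_lt_one])]
    linarith [m.γ_pos]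
  have hS : (1 : ℝ) ≤ Fintype.card S := by exact_mod_cast Fintype.card_pos
  have hA : (1 : ℝ) ≤ Fintype.card A := by exact_mod_cast Fintype.card_pos
  have hA0 : (0 : ℝ) < Fintype.card A := by linarith
  have hD0 : 0 < Metric.diam rewards := hτ.trans hτD
  have hR0 := MDPModel.rewardBound_nonneg rewards
  set R := rewardBound rewards
  set D := Metric.diam rewards
  set H := m.horizon
  have hks := isSeparableKernel_shannon hτ
  have hkt := isSeparableKernel_tsallis hτ
  refine ⟨⟨?_, ?_⟩, ?_, ?_⟩
  · exact MDPModel.isRegular_of_kernel (generates_shannon τ) hks hτ.le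
      (simplexStrongConvex_shannon hτ) hνmin hν
  · refine MDPModel.isDualConstant_of_kernel (generates_shannon τ) hks hτ
      (simplexStrongConvex_shannon hτ) hνmin hν (B := τ * Real.log (Fintype.card A))
      (fun p hp => sum_shannon_nonpos hτ hp) (fun p hp => sum_shannon_ge hτ hp) hrewards rfl hτ hτD
      -- Here `K δ = τ / δ`, so `κ = δ` works with equality. The argument yields a constant larger
      -- than the stated one by `|S| |A|`.
      (fun p hp hpos a h => shannon_policy_ge hτ hA0 hp hpos a h) (by positivity) le_rfl le_rfl ?_
    rw [Real.rpow_add hA0, Real.rpow_neg hA0.le, Real.rpow_two]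
    have hpow : 0 < (Fintype.card A : ℝ) ^ H := Real.rpow_pos_of_pos hA0 H
    set c : ℝ := (Fintype.card A : ℝ)
    set n : ℝ := (Fintype.card S : ℝ)
    set x := Real.exp (-2 * R * H / τ) with hx
    have hx0 : 0 < x := Real.exp_pos _
    have e : νmin * (x * (c ^ H)⁻¹) / (2 * c * D) = x * νmin / (2 * D * c * c ^ H) := by field_simp
    rw [e]
    refine div_le_div_of_nonneg_left (by positivity) (by positivity) ?_
    have h1 : 1 ≤ n * c := one_le_mul_of_one_le_of_one_le hS hA
    calc 2 * D * c * c ^ H = 2 * D * c * c ^ H * 1 := (mul_one _).symm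
      _ ≤ 2 * D * c * c ^ H * (n * c) := by gcongr
      _ = _ := by ring
  · have := MDPModel.isRegular_of_kernel (generates_tsallis τ) hkt
      (show 0 ≤ τ / (2 * Fintype.card A) by positivity) (simplexStrongConvex_tsallis hτ) hνmin hν
    rwa [show τ / (2 * Fintype.card A) * νmin / H ^ 2
      = τ * νmin / (2 * H ^ 2 * Fintype.card A) by field_simp] at this
  · have hc1 : 1 ≤ √(Fintype.card A : ℝ) := Real.one_le_sqrt.2 hA
    set B := (2 * R / τ + 3 * √(Fintype.card A : ℝ)) * H with hB
    have hB1 : 1 ≤ B := by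
      have : 0 ≤ 2 * R / τ := by positivity
      exact one_le_mul_of_one_le_of_one_le (by linarith) hH1
    have hB0 : 0 < B := by linarith
    refine MDPModel.isDualConstant_of_kernel (generates_tsallis τ) hkt
      (show 0 < τ / (2 * Fintype.card A) by positivity) (simplexStrongConvex_tsallis hτ) hνmin hν
      -- With `δ = 1 / B²`, `K δ = τ / δ^(3/2) = τ B³`, which forces `κ = 1 / B³` and explains the
      -- cube. The slack in the stated constant is `√2 |S|`.
      (B := 2 * τ * (√(Fintype.card A : ℝ) - 1)) (κ := 1 / B ^ 3) (δ := 1 / B ^ 2) (τ := τ)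
      (fun p hp => sum_tsallis_nonpos hτ hp) (fun p hp => sum_tsallis_ge hτ hp) hrewards rfl hτ hτD
      (fun p hp hpos a h => tsallis_policy_ge hτ hR0 hH1 hc1 hp hpos a h) (by positivity) ?_ ?_ ?_
    · exact one_div_le_one_div_of_le (by positivity) (pow_le_pow_right₀ hB1 (by norm_num))
    · rw [Real.sqrt_div zero_le_one, Real.sqrt_one, Real.sqrt_sq hB0.le]
      refine le_of_eq ?_
      field_simp
    · set c : ℝ := (Fintype.card A : ℝ)
      set n : ℝ := (Fintype.card S : ℝ)
      have e : νmin * (1 / B ^ 3) / (2 * c * D) = νmin / (2 * D * c * B ^ 3) := by field_simp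
      rw [e]
      refine div_le_div_of_nonneg_left hνmin.le (by positivity) ?_
      have h2 : 1 ≤ √(2 : ℝ) := Real.one_le_sqrt.2 one_le_two
      have h1 : 1 ≤ √2 * n := one_le_mul_of_one_le_of_one_le h2 hS
      calc 2 * D * c * B ^ 3 = 2 * D * c * B ^ 3 * 1 := (mul_one _).symm
        _ ≤ 2 * D * c * B ^ 3 * (√2 * n) := by gcongr
        _ = _ := by ring
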